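/- **Setting.** For $i=1,\dots,n$ let $X^i$ be an ultrametric metric space which is *regular*: (1) the set of balls of nonzero diameter is at most countable; (2) for each strictly decreasing sequence of balls the diameters tend to $0$; (3) every ball of nonzero diameter is a finite union of its maximal subballs. Here a ball is a set $\{y: d(x,y)\le r\}$, $r\ge 0$. Assume also that all balls in $X^i$ are compact, and let $\nu^i$ be a Borel measure on $X^i$ which is finite on compact sets and positive on nonempty open sets. The tree $\mathcal T(X^i)$ consists of all balls of nonzero diameter (the non-minimal vertices) and of those one-point sets which are maximal subballs of balls of nonzero diameter. The number of maximal subballs of $I$ is $p_I$. For each ball $I\subset X^i$ of nonzero diameter fix an orthonormal basis $\Psi_{Ij}$, $j=1,\dots,p_I-1$, of the space $V^0(I)\subset L^2(X^i,\nu^i)$ of linear combinations with $\nu^i$-mean zero of characteristic functions of maximal subballs of $I$ (wavelets). Let $X=X^1\times\dots\times X^n$, $\nu=\nu^1\times\dots\times\nu^n$. Let $D(X^i)$ be the space of complex locally constant functions with compact support on $X^i$, $D_0(X^i)$ its subspace of functions with mean zero, $D(X)=\bigotimes_i D(X^i)$, $D_0(X)=\bigotimes_i D_0(X^i)$, and let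 $D'(X)$ and $D_0'(X)$ (the Lizorkin distributions) be the spaces of all linear functionals on $D(X)$ and $D_0(X)$. Let $K_i$ be a complex function on the balls of $X^i$ such that $\sum_{J\supsetneq R}|K_i(J)|\,(\nu^i(J)-\nu^i(J(R)))<\infty$ for some ball $R$, where $J(R)$ is the maximal subball of $J$ that contains $R$. Put $$T_iF(x)=\int_{X^i}K_i(\sup(x^i,y))\,\bigl(F(x)-F(x^1,\dots,y,\dots,x^n)\bigr)\,d\nu^i(y),\qquad T=\sum_{k=1}^m\sum_{i_1,\dots,i_k=1}^n a^{(k)}_{i_1\dots i_k}T_{i_1}\cdots T_{i_k},$$ where $\sup(x^i,y)$ is the smallest ball containing $x^i$ and $y$, $y$ stands in the $i$-th place, and $a^{(k)}_{i_1\dots i_k}\in\mathbb C$. For a ball $I\subset X^i$ of nonzero diameter put $\lambda_I=K_i(I)\nu^i(I)+\sum_{J\supsetneq I}K_i(J)(\nu^i(J)-\nu^i(J(I)))$, and for a product $\mathbf I=I^1\times\dots\times I^n$ of such balls put $$\lambda_{\mathbf I}=\sum_{k=1}^m\sum_{i_1,\dots,i_k=1}^n a^{(k)}_{i_1\dots i_k}\lambda_{I^{i_1}}\cdots\lambda_{I^{i_k}}.$$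 Call $\mathbf I$ characteristic if $\lambda_{\mathbf I}=0$. For $u\in D'(X)$ the distribution $Tu\in D_0'(X)$ is defined by $(Tu)(\varphi)=u(T\varphi)$, $\varphi\in D_0(X)$. Fix $I_0^i\in\mathcal T(X^i)$ with $\nu^i(I_0^i)>0$ for $i=1,\dots,n$. Add to the wavelets on $X^i$ the function $\Psi_{I_0^i0}=\chi_{I_0^i}$ (with index $j=0$, which is allowed only for $I^i=I_0^i$), and put $\Psi_{\mathbf I\mathbf j}=\bigotimes_i\Psi_{I^ij^i}$. It is a wavelet if all $j^i\ne0$. Put $$G_{\mathbf I\mathbf j}=\bigotimes_{i:\,j^i\neq0}\Bigl(\Psi_{I^ij^i}-\frac1{\nu^i(I_0^i)}\int_{I_0^i}\Psi_{I^ij^i}\,d\nu^i\Bigr)$$ (constant in the variables $x^i$ with $j^i=0$), acting on $D(X)$ by $G_{\mathbf I\mathbf j}(\varphi)=\int_X G_{\mathbf I\mathbf j}\,\varphi\,d\nu$. **Cauchy problem.** Given $f\in D_0'(X)$ and arbitrary complex numbers $u_{\mathbf I\mathbf j}$ for the indices such that at least one $j^i$ is $0$, find $u\in D'(X)$ such that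 $Tu=f$ and $$u\bigl(\overline{\Psi_{\mathbf I\mathbf j}}\bigr)=u_{\mathbf I\mathbf j}\prod_{i:\,j^i=0}\nu^i(I_0^i)\qquad\text{whenever some } j^i=0.$$ **Theorem.** Put $f_{\mathbf I\mathbf j}=f(\overline{\Psi_{\mathbf I\mathbf j}})$ for wavelets $\Psi_{\mathbf I\mathbf j}$, and assume that $f_{\mathbf I\mathbf j}=0$ for all wavelets with $\mathbf I$ characteristic. Then: 1. $T\Psi_{\mathbf I\mathbf j}=\lambda_{\mathbf I}\Psi_{\mathbf I\mathbf j}$ for every wavelet. 2. For every choice of complex numbers $u_{\mathbf I\mathbf j}$ for the wavelets with $\mathbf I$ characteristic, the Cauchy problem has exactly one solution $u$ such that $u(\overline{\Psi_{\mathbf I\mathbf j}})=u_{\mathbf I\mathbf j}$ for these wavelets. 3. For every such choice, a functional $u\in D'(X)$ is this solution if and only if $$u=\sum_{\text{some }j^i=0}u_{\mathbf I\mathbf j}G_{\mathbf I\mathbf j}+\sum_{\text{all }j^i\ne0,\ \lambda_{\mathbf I}\neq0}\frac{f_{\mathbf I\mathbf j}}{\lambda_{\mathbf I}}G_{\mathbf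 I\mathbf j}+\sum_{\text{all }j^i\ne0,\ \lambda_{\mathbf I}=0}u_{\mathbf I\mathbf j}G_{\mathbf I\mathbf j},$$ where each of the three series converges unconditionally when applied to any test function in $D(X)$. 4. If no $\mathbf I$ is characteristic, the Cauchy problem has exactly one solution. -/

import Mathlib

open MeasureTheory Set Filter Topology
open scoped ComplexConjugate

namespace Ultra

/-! ### One-dimensional notions: balls, the tree of balls, regular spaces -/

section OneDim

variable {X : Type*} [MetricSpace X]

/-- A ball `{y | d(y, x) ≤ r}` with `r ≥ 0`; one-point sets are the balls of zero diameter. -/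
def IsBall (I : Set X) : Prop := ∃ (x : X) (r : ℝ), 0 ≤ r ∧ I = Metric.closedBall x r

/-- `J` is a maximal (proper) subball of `I`. -/
def IsMaxSubball (J I : Set X) : Prop :=
  IsBall J ∧ J ⊂ I ∧ ∀ L : Set X, IsBall L → J ⊂ L → L ⊆ I → L = I

/-- Regular ultrametric spaces. In the second condition the sequences of balls are strictly
decreasing. A set has nonzero diameter iff it is `Set.Nontrivial`. -/
structure IsRegular (X : Type*) [MetricSpace X] [IsUltrametricDist X] : Prop where
  countable_balls : {I : Set X | IsBall I ∧ I.Nontrivial}.Countable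
  diam_tendsto : ∀ B : ℕ → Set X, (∀ k, IsBall (B k)) → (∀ k, B (k + 1) ⊂ B k) →
    Tendsto (fun k => Metric.diam (B k)) atTop (𝓝 0)
  finite_union : ∀ I : Set X, IsBall I → I.Nontrivial →
    {J : Set X | IsMaxSubball J I}.Finite ∧ ⋃₀ {J : Set X | IsMaxSubball J I} = I

/-- Vertices of the tree of balls: the balls of nonzero diameter, and the balls of zero diameter
that are maximal subballs of balls of nonzero diameter. -/
def IsVertex (I : Set X) : Prop :=
  IsBall I ∧ (I.Nontrivial ∨ ∃ J : Set X, IsBall J ∧ J.Nontrivial ∧ IsMaxSubball I J)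

/-- The tree of balls, as a type. -/
abbrev Vertex (X : Type*) [MetricSpace X] := {I : Set X // IsVertex I}

/-- The non-minimal vertices of the tree: the balls of nonzero diameter. -/
abbrev BigBall (X : Type*) [MetricSpace X] := {I : Set X // IsBall I ∧ I.Nontrivial}

/-- The branching index `p_I`: the number of maximal subballs of `I`. -/
noncomputable def branchingIndex (I : Set X) : ℕ := {J : Set X | IsMaxSubball J I}.ncard

/-- `J(I)`: the maximal subball of `J` that contains `I` (for balls `I ⊂ J`). -/
def childContaining (J I : Set X) : Set X := ⋃₀ {L : Set X | IsMaxSubball L J ∧ I ⊆ L}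

/-- `sup(x, y)`: the smallest ball that contains `x` and `y`. -/
def supBall (x y : X) : Set X := Metric.closedBall x (dist x y)

/-- The characteristic function of a set, with complex values. -/
noncomputable def chi (I : Set X) : X → ℂ := I.indicator fun _ => 1

/-- One-dimensional test functions `D(X)`: locally constant functions with compact support. -/
def IsTest (φ : X → ℂ) : Prop := IsLocallyConstant φ ∧ HasCompactSupport φ

variable [MeasurableSpace X]

/-- One-dimensional Lizorkin test functions `D₀(X)`: test functions with zero mean. -/
def IsTestZero (ν : Measure X) (φ : X → ℂ) : Prop := IsTest φ ∧ ∫ x, φ x ∂ν = 0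

/-- The space `V(I)` spanned by the characteristic functions of the maximal subballs of `I`. -/
def ballSpace (I : Set X) : Submodule ℂ (X → ℂ) :=
  Submodule.span ℂ {g | ∃ J : Set X, IsMaxSubball J I ∧ g = chi J}

/-- The wavelet space `V⁰(I)`: the functions in `V(I)` with zero mean. -/
def waveletSpace (ν : Measure X) (I : Set X) : Set (X → ℂ) :=
  {g | g ∈ ballSpace I ∧ ∫ x, g x ∂ν = 0}

/-- A choice of ultrametric wavelets on `X`: for every ball `I` of nonzero diameter an orthonormal
basis of the wavelet space `V⁰(I)`. The index `j = 1, …, p_I - 1` runs over `Fin (p_I - 1)`. -/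
structure Wavelets (ν : Measure X) where
  fn : (I : BigBall X) → Fin (branchingIndex I.1 - 1) → X → ℂ
  orthonormal : ∀ I j k, ∫ x, conj (fn I j x) * fn I k x ∂ν = if j = k then 1 else 0
  span_eq : ∀ I, (Submodule.span ℂ (range (fn I)) : Set (X → ℂ)) = waveletSpace ν I.1

/-- Indices `(I, j)` of one-dimensional wavelets. -/
abbrev WIdx (X : Type*) [MetricSpace X] := (I : BigBall X) × Fin (branchingIndex I.1 - 1)

/-- The convergence condition on the kernel `K` of an ultrametric pseudodifferential operator:
`∑_{J > R} |K(J)| (ν(J) - ν(J(R))) < ∞` for some ball `R`. -/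
def KernelConverges (ν : Measure X) (K : Set X → ℂ) : Prop :=
  ∃ R : Set X, IsBall R ∧ Summable fun J : {J : BigBall X // R ⊂ J.1} =>
    ‖K J.1.1‖ * (ν.real J.1.1 - ν.real (childContaining J.1.1 R))

/-- `λ_I = K(I) ν(I) + ∑_{J > I} K(J) (ν(J) - ν(J(I)))`. -/
noncomputable def eigenvalue₁ (ν : Measure X) (K : Set X → ℂ) (I : Set X) : ℂ :=
  K I * (ν.real I : ℂ) + ∑' J : {J : BigBall X // I ⊂ J.1},
    K J.1.1 * ((ν.real J.1.1 - ν.real (childContaining J.1.1 I) : ℝ) : ℂ)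

/-- The functions `Ψ_{Ij}` on one factor. The index `some (I, j)` gives the wavelet `Ψ_{Ij}`,
`j ≠ 0`; the index `none` stands for the pair `(I₀, 0)` and gives `χ_{I₀}`. -/
noncomputable def psi₁ {ν : Measure X} (W : Wavelets ν) (I₀ : Vertex X) :
    Option (WIdx X) → X → ℂ
  | none => chi I₀.1
  | some p => W.fn p.1 p.2

/-- The factor `Ψ_{Ij} - ν(I₀)⁻¹ Ψ_{Ij}(χ_{I₀})` of a term of the series if `j ≠ 0`, and the factor
`1` if `j = 0`. -/
noncomputable def seriesFactor {ν : Measure X} (W : Wavelets ν) (I₀ : Vertex X) :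
    Option (WIdx X) → X → ℂ
  | none => fun _ => 1
  | some p => fun x =>
      W.fn p.1 p.2 x - 1 / (ν.real I₀.1 : ℂ) * ∫ y, W.fn p.1 p.2 y * chi I₀.1 y ∂ν

end OneDim

/-! ### Products of ultrametric spaces -/

section MultiDim

variable {n : ℕ} {X : Fin n → Type*} [∀ i, MetricSpace (X i)]

/-- Test functions `D(X) = ⊗ D(X^i)`, realized as functions on the product. -/
def TestSpace (X : Fin n → Type*) [∀ i, MetricSpace (X i)] : Submodule ℂ ((∀ i, X i) → ℂ) :=
  Submodule.span ℂ {F | ∃ φ : ∀ i, X i → ℂ, (∀ i, IsTest (φ i)) ∧ F = fun x => ∏ i, φ i (x i)}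

/-- Generalized functions `D'(X)`: all linear functionals on `D(X)`. -/
abbrev GenFun (X : Fin n → Type*) [∀ i, MetricSpace (X i)] := Module.Dual ℂ (TestSpace X)

variable [∀ i, MeasurableSpace (X i)] (ν : ∀ i, Measure (X i))

/-- Lizorkin test functions `D₀(X) = ⊗ D₀(X^i)`, realized as functions on the product. -/
def LizorkinTestSpace : Submodule ℂ ((∀ i, X i) → ℂ) :=
  Submodule.span ℂ {F | ∃ φ : ∀ i, X i → ℂ, (∀ i, IsTestZero (ν i) (φ i)) ∧
    F = fun x => ∏ i, φ i (x i)}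

/-- Lizorkin generalized functions `D₀'(X)`: all linear functionals on `D₀(X)`. -/
abbrev LizorkinGenFun := Module.Dual ℂ (LizorkinTestSpace ν)

/-- The operator `T_i`, with kernel `K i`, in the `i`-th variable:
`(T_i F)(x) = ∫ K_i(sup(x^i, y)) (F(x) - F(x^1, …, y, …, x^n)) dν^i(y)`.
Only the values of `K i` on balls of nonzero diameter matter. -/
noncomputable def pdo₁ (K : ∀ i, Set (X i) → ℂ) (i : Fin n) (F : (∀ i, X i) → ℂ) :
    (∀ i, X i) → ℂ :=
  fun x => ∫ y, K i (supBall (x i) y) * (F x - F (Function.update x i y)) ∂(ν i)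

/-- `T = ∑_{k=1}^m ∑_{i_1, …, i_k} a^{(k)}_{i_1 … i_k} T_{i_1} ⋯ T_{i_k}`. -/
noncomputable def pdo (K : ∀ i, Set (X i) → ℂ) (m : ℕ) (a : (k : ℕ) → (Fin k → Fin n) → ℂ)
    (F : (∀ i, X i) → ℂ) : (∀ i, X i) → ℂ :=
  fun x => ∑ k ∈ Finset.Icc 1 m, ∑ s : Fin k → Fin n,
    a k s * (List.ofFn s).foldr (pdo₁ ν K) F x

/-- `λ_I = ∑_{k=1}^m ∑_{i_1, …, i_k} a^{(k)}_{i_1 … i_k} λ_{I^{i_1}} ⋯ λ_{I^{i_k}}`. -/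
noncomputable def eigenvalue (K : ∀ i, Set (X i) → ℂ) (m : ℕ)
    (a : (k : ℕ) → (Fin k → Fin n) → ℂ) (I : ∀ i, BigBall (X i)) : ℂ :=
  ∑ k ∈ Finset.Icc 1 m, ∑ s : Fin k → Fin n,
    a k s * ∏ l, eigenvalue₁ (ν (s l)) (K (s l)) (I (s l)).1

/-- `I` is characteristic for `T`. -/
def IsCharacteristic (K : ∀ i, Set (X i) → ℂ) (m : ℕ)
    (a : (k : ℕ) → (Fin k → Fin n) → ℂ) (I : ∀ i, BigBall (X i)) : Prop :=
  eigenvalue ν K m a I = 0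

/-- `Tu = f` in `D₀'(X)`, where `(Tu)(φ) = u(Tφ)` for `φ ∈ D₀(X)` (the kernels are symmetric, so
`T` is its own transpose for the bilinear pairing). -/
def SolvesEquation (K : ∀ i, Set (X i) → ℂ) (m : ℕ) (a : (k : ℕ) → (Fin k → Fin n) → ℂ)
    (u : GenFun X) (f : LizorkinGenFun ν) : Prop :=
  ∀ φ : LizorkinTestSpace ν, ∃ h : pdo ν K m a φ.1 ∈ TestSpace X, u ⟨pdo ν K m a φ.1, h⟩ = f φ

/-- Multi-indices `(I, j)` of all the functions `Ψ_{Ij} ≠ 0`; in the `i`-th place `none` stands for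
`(I₀^i, 0)`. (The pairs with `j^i = 0`, `I^i ≠ I₀^i` belong to `Ψ_{Ij} = 0` and are left out.) -/
abbrev MIdx (X : Fin n → Type*) [∀ i, MetricSpace (X i)] := ∀ i, Option (WIdx (X i))

/-- Multi-indices `(I, j)` of multidimensional wavelets (all `j^i ≠ 0`). -/
abbrev MWIdx (X : Fin n → Type*) [∀ i, MetricSpace (X i)] := ∀ i, WIdx (X i)

/-- Multi-indices of the initial conditions: at least one `j^i` is zero. -/
abbrev InitIdx (X : Fin n → Type*) [∀ i, MetricSpace (X i)] := {α : MIdx X // ∃ i, α i = none}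

/-- The product of balls `I` of a wavelet index `(I, j)`. -/
def MWIdx.ball (β : MWIdx X) : ∀ i, BigBall (X i) := fun i => (β i).1

/-- A wavelet index as an index of the whole family `Ψ_{Ij}`. -/
def MWIdx.toMIdx (β : MWIdx X) : MIdx X := fun i => some (β i)

variable {ν}

/-- `Ψ_{Ij} = ⊗_i Ψ_{I^i j^i}`. -/
noncomputable def psi (W : ∀ i, Wavelets (ν i)) (I₀ : ∀ i, Vertex (X i)) (α : MIdx X) :
    (∀ i, X i) → ℂ := fun x => ∏ i, psi₁ (W i) (I₀ i) (α i) (x i)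

/-- The multidimensional wavelets `Ψ_{Ij}`, all `j^i ≠ 0`. -/
noncomputable def wavelet (W : ∀ i, Wavelets (ν i)) (β : MWIdx X) : (∀ i, X i) → ℂ :=
  fun x => ∏ i, (W i).fn (β i).1 (β i).2 (x i)

/-- The action on `φ` of the function `⊗_{i : j^i ≠ 0} (Ψ_{I^i j^i} - ν^i(I₀^i)⁻¹ Ψ_{I^i j^i}(χ_{I₀^i}))`,
that is, the integral of its product with `φ` with respect to the product measure. -/
noncomputable def seriesTerm (W : ∀ i, Wavelets (ν i)) (I₀ : ∀ i, Vertex (X i)) (α : MIdx X)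
    (φ : (∀ i, X i) → ℂ) : ℂ :=
  ∫ x, (∏ i, seriesFactor (W i) (I₀ i) (α i) (x i)) * φ x ∂(Measure.pi ν)

end MultiDim

/-! ### The functions `conj Ψ_{Ij}` are test functions -/

section Facts

variable {X : Type*} [MetricSpace X]

lemma IsMaxSubball.isOpen [IsUltrametricDist X] {J I : Set X} (h : IsMaxSubball J I)
    (hI : IsBall I) : IsOpen J := by
  obtain ⟨⟨x, r, hr, rfl⟩, hss, hmax⟩ := h
  rcases hr.lt_or_eq with hr | rfl
  · exact IsUltrametricDist.isOpen_closedBall x hr.ne'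
  rw [Metric.closedBall_zero] at hss hmax ⊢
  obtain ⟨z, hzI, hzx⟩ : ∃ z ∈ I, z ≠ x := by
    obtain ⟨z, hz, hne⟩ := exists_of_ssubset hss
    exact ⟨z, hz, by simpa using hne⟩
  have hd : 0 < dist z x := dist_pos.2 hzx
  obtain ⟨c, s, hs, rfl⟩ := hI
  have hxI : x ∈ Metric.closedBall c s := hss.1 rfl
  rw [IsUltrametricDist.closedBall_eq_of_mem hxI] at hzI hss hmax hxI
  refine Metric.isOpen_iff.2 fun y hy => ?_
  rw [mem_singleton_iff] at hy
  subst hy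
  refine ⟨dist z y, hd, fun w hw => ?_⟩
  rw [Metric.mem_ball] at hw
  by_contra hwy
  rw [mem_singleton_iff] at hwy
  have hzs : dist z y ≤ s := hzI
  have hw0 : w ∈ Metric.closedBall y (dist w y) := by simp
  have hEq := hmax (Metric.closedBall y (dist w y)) ⟨y, _, dist_nonneg, rfl⟩
    ⟨by simp, fun hc => hwy (by simpa using hc hw0)⟩
    (Metric.closedBall_subset_closedBall (by linarith))
  rw [← hEq, Metric.mem_closedBall] at hzI
  linarith

lemma IsVertex.isOpen [IsUltrametricDist X] {I : Set X} (h : IsVertex I) : IsOpen I := by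
  obtain ⟨⟨x, r, hr, rfl⟩, h | ⟨J, hJ, -, h⟩⟩ := h
  · rcases hr.lt_or_eq with hr | rfl
    · exact IsUltrametricDist.isOpen_closedBall x hr.ne'
    · simp at h
  · exact h.isOpen hJ

lemma isTest_chi [ProperSpace X] {I : Set X} (hI : IsBall I) (ho : IsOpen I) :
    IsTest (chi I) := by
  obtain ⟨x, r, hr, rfl⟩ := hI
  refine ⟨(IsLocallyConstant.iff_exists_open _).2 fun y => ?_, ?_⟩
  · by_cases hy : y ∈ Metric.closedBall x r
    · exact ⟨_, ho, hy, fun z hz => by simp [chi, hy, hz]⟩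
    · exact ⟨_, Metric.isClosed_closedBall.isOpen_compl, hy, fun z hz => by
        rw [mem_compl_iff] at hz
        simp [chi, hy, hz]⟩
  exact HasCompactSupport.intro (isCompact_closedBall x r) fun y hy => by
    simp [chi, hy]

lemma IsTest.add {φ ψ : X → ℂ} (h : IsTest φ) (h' : IsTest ψ) : IsTest (φ + ψ) :=
  ⟨h.1.add h'.1, h.2.add h'.2⟩

lemma IsTest.smul {φ : X → ℂ} (c : ℂ) (h : IsTest φ) : IsTest (c • φ) :=
  ⟨h.1.comp (fun z => c • z), h.2.comp_left (g := fun z => c • z) (by simp)⟩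

lemma IsTest.conj {φ : X → ℂ} (h : IsTest φ) : IsTest (fun x => conj (φ x)) :=
  ⟨h.1.comp (fun z => (starRingEnd ℂ) z),
    h.2.comp_left (g := fun z => (starRingEnd ℂ) z) (by simp)⟩

lemma isTest_of_mem_ballSpace [MeasurableSpace X] [ProperSpace X] [IsUltrametricDist X]
    {I : Set X} (hI : IsBall I) {g : X → ℂ} (hg : g ∈ ballSpace I) : IsTest g := by
  induction hg using Submodule.span_induction with
  | mem g hg =>
    obtain ⟨J, hJ, rfl⟩ := hg
    exact isTest_chi hJ.1 (hJ.isOpen hI)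
  | zero => exact ⟨IsLocallyConstant.const 0, HasCompactSupport.zero⟩
  | add f g _ _ hf hg => exact hf.add hg
  | smul c f _ hf => exact hf.smul c

lemma Wavelets.mem [MeasurableSpace X] {ν : Measure X} (W : Wavelets ν) (p : WIdx X) :
    W.fn p.1 p.2 ∈ waveletSpace ν p.1.1 := by
  rw [← W.span_eq]
  exact Submodule.subset_span ⟨p.2, rfl⟩

lemma Wavelets.isTest [MeasurableSpace X] [ProperSpace X] [IsUltrametricDist X]
    {ν : Measure X} (W : Wavelets ν) (p : WIdx X) : IsTest (W.fn p.1 p.2) :=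
  isTest_of_mem_ballSpace p.1.2.1 (W.mem p).1

end Facts

section Conj

variable {n : ℕ} {X : Fin n → Type*} [∀ i, MetricSpace (X i)] [∀ i, IsUltrametricDist (X i)]
  [∀ i, ProperSpace (X i)] [∀ i, MeasurableSpace (X i)] {ν : ∀ i, Measure (X i)}

/-- `conj Ψ_{Ij}` as an element of `D(X)`. -/
noncomputable def conjPsi (W : ∀ i, Wavelets (ν i)) (I₀ : ∀ i, Vertex (X i)) (α : MIdx X) :
    TestSpace X :=
  ⟨fun x => conj (psi W I₀ α x), Submodule.subset_span
    ⟨fun i y => conj (psi₁ (W i) (I₀ i) (α i) y), fun i => by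
      rcases h : α i with _ | p
      · simpa [psi₁, h] using (isTest_chi (I₀ i).2.1 (I₀ i).2.isOpen).conj
      · simpa [psi₁, h] using ((W i).isTest p).conj, by
      funext x
      simp [psi, map_prod]⟩⟩

/-- `conj Ψ_{Ij}`, for a wavelet `Ψ_{Ij}`, as an element of `D₀(X)`. -/
noncomputable def conjWavelet (W : ∀ i, Wavelets (ν i)) (β : MWIdx X) : LizorkinTestSpace ν :=
  ⟨fun x => conj (wavelet W β x), Submodule.subset_span
    ⟨fun i y => conj ((W i).fn (β i).1 (β i).2 y), fun i =>
      ⟨((W i).isTest (β i)).conj, by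
        rw [integral_conj, ((W i).mem (β i)).2, map_zero]⟩, by
      funext x
      simp [wavelet, map_prod]⟩⟩

/-- `u` solves the Cauchy problem: `Tu = f` and the initial conditions
`u(conj Ψ_{Ij}) = u_{Ij} ∏_{i : j^i = 0} ν^i(I₀^i)` hold for all `(I, j)` such that some `j^i = 0`. -/
def IsCauchySolution (W : ∀ i, Wavelets (ν i)) (I₀ : ∀ i, Vertex (X i))
    (K : ∀ i, Set (X i) → ℂ) (m : ℕ) (a : (k : ℕ) → (Fin k → Fin n) → ℂ)
    (f : LizorkinGenFun ν) (u₀ : InitIdx X → ℂ) (u : GenFun X) : Prop :=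
  SolvesEquation ν K m a u f ∧
    ∀ α : InitIdx X, u (conjPsi W I₀ α.1) =
      u₀ α * ∏ i with α.1 i = none, ((ν i).real (I₀ i).1 : ℂ)

/-- `u` is the sum, weakly in `D'(X)`, of the three wavelet series: over the initial conditions, over
the non-characteristic `I` with coefficients `f_{Ij} / λ_I`, and over the characteristic `I` with
coefficients `c_{Ij}`. -/
def IsSeriesSum (W : ∀ i, Wavelets (ν i)) (I₀ : ∀ i, Vertex (X i))
    (K : ∀ i, Set (X i) → ℂ) (m : ℕ) (a : (k : ℕ) → (Fin k → Fin n) → ℂ)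
    (f : LizorkinGenFun ν) (u₀ : InitIdx X → ℂ)
    (c : {β : MWIdx X // IsCharacteristic ν K m a β.ball} → ℂ) (u : GenFun X) : Prop :=
  ∀ φ : TestSpace X, ∃ s₁ s₂ s₃ : ℂ,
    HasSum (fun α : InitIdx X => u₀ α * seriesTerm W I₀ α.1 φ.1) s₁ ∧
    HasSum (fun β : {β : MWIdx X // ¬ IsCharacteristic ν K m a β.ball} =>
      1 / eigenvalue ν K m a β.1.ball * f (conjWavelet W β.1) *
        seriesTerm W I₀ β.1.toMIdx φ.1) s₂ ∧
    HasSum (fun β : {β : MWIdx X // IsCharacteristic ν K m a β.ball} =>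
      c β * seriesTerm W I₀ β.1.toMIdx φ.1) s₃ ∧
    u φ = s₁ + s₂ + s₃

end Conj

end Ultra

set_option linter.unusedSectionVars false

/-! The functions `conj Ψ_{Ij}`, wavelets and mixed ones together, form a Hamel basis of `D(X)`, and
those with all `j^i ≠ 0` span `D₀(X)`. A functional on `D(X)` is therefore an arbitrary family of
values on this basis. In it the equation is diagonal: `Tu = f` says `λ_I u(conj Ψ_{Ij}) = f(conj
Ψ_{Ij})` for each wavelet (`solvesEquation_iff`). Non-characteristic indices get their value by
division, characteristic ones are free because `f` vanishes there, and the initial conditions fix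
the rest.

Three one-dimensional facts carry this. A wavelet of `I` is an eigenfunction because, for `x ∈ I`,
the kernel is constant on each shell `J \ J(I)` around `I`, while the wavelet is constant on the
maximal subballs of `I` (`IsRegular.integral_kernel_wavelet`). Wavelets and a single `χ_{I₀}` span
all test functions, by descent in the tree and compactness (`IsRegular.isTest_mem`). The factors of
`G_{Ij}` are biorthogonal to the `Ψ_{Ij}` (`IsRegular.integral_seriesFactor_mul_conj`).

By biorthogonality the `G_{Ij}` are, up to nonzero weights, the coordinate functionals of the basis.
This gives linear independence and the series formula; on any test function only finitely many terms
are nonzero, so unconditional convergence is automatic. -/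

namespace Ultra

/-! ### Balls in an ultrametric space and descent in the tree. -/

section Geometry

lemma nontrivial_of_ssubset {α : Type*} {I J : Set α} (hI : I.Nonempty) (h : I ⊂ J) : J.Nontrivial := by
  obtain ⟨x, hx⟩ := hI
  obtain ⟨y, hy, hyI⟩ := exists_of_ssubset h
  exact ⟨x, h.subset hx, y, hy, fun e => hyI (e ▸ hx)⟩

variable {X : Type*} [MetricSpace X]

lemma IsBall.nonempty {I : Set X} (hI : IsBall I) : I.Nonempty := by
  obtain ⟨x, r, hr, rfl⟩ := hI
  exact ⟨x, Metric.mem_closedBall_self hr⟩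

lemma IsBall.isBounded {I : Set X} (hI : IsBall I) : Bornology.IsBounded I := by
  obtain ⟨x, r, -, rfl⟩ := hI
  exact Metric.isBounded_closedBall

lemma IsBall.isClosed {I : Set X} (hI : IsBall I) : IsClosed I := by
  obtain ⟨x, r, -, rfl⟩ := hI
  exact Metric.isClosed_closedBall

lemma IsBall.isCompact [ProperSpace X] {I : Set X} (hI : IsBall I) : IsCompact I := by
  obtain ⟨x, r, -, rfl⟩ := hI
  exact isCompact_closedBall x r

lemma isBall_supBall (x y : X) : IsBall (supBall x y) := ⟨x, _, dist_nonneg, rfl⟩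

lemma left_mem_supBall (x y : X) : x ∈ supBall x y := Metric.mem_closedBall_self dist_nonneg

lemma right_mem_supBall (x y : X) : y ∈ supBall x y := by
  simp [supBall, dist_comm]

/-- A ball that contains a given bounded set. -/
lemma exists_isBall_superset [Nonempty X] {s : Set X} (hs : Bornology.IsBounded s) :
    ∃ A, IsBall A ∧ s ⊆ A := by
  obtain ⟨c⟩ := ‹Nonempty X›
  obtain ⟨r, hr⟩ := hs.subset_closedBall c
  exact ⟨_, ⟨c, max r 0, le_max_right _ _, rfl⟩,
    hr.trans (Metric.closedBall_subset_closedBall (le_max_left _ _))⟩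

lemma IsMaxSubball.isVertex {C J : Set X} (hC : IsMaxSubball C J) (hJ : IsBall J)
    (hn : J.Nontrivial) : IsVertex C := ⟨hC.1, .inr ⟨J, hJ, hn, hC⟩⟩

variable [IsUltrametricDist X]

lemma IsBall.eq_closedBall {I : Set X} (hI : IsBall I) {x : X} (hx : x ∈ I) :
    ∃ r, 0 ≤ r ∧ I = Metric.closedBall x r := by
  obtain ⟨c, r, hr, rfl⟩ := hI
  exact ⟨r, hr, IsUltrametricDist.closedBall_eq_of_mem hx⟩

lemma IsBall.subset_or_subset {I J : Set X} (hI : IsBall I) (hJ : IsBall J) {x : X}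
    (hxI : x ∈ I) (hxJ : x ∈ J) : I ⊆ J ∨ J ⊆ I := by
  obtain ⟨r, -, rfl⟩ := hI.eq_closedBall hxI
  obtain ⟨s, -, rfl⟩ := hJ.eq_closedBall hxJ
  exact (le_total r s).imp Metric.closedBall_subset_closedBall Metric.closedBall_subset_closedBall

lemma IsBall.supBall_subset {I : Set X} (hI : IsBall I) {x y : X} (hx : x ∈ I) (hy : y ∈ I) :
    supBall x y ⊆ I := by
  obtain ⟨r, -, rfl⟩ := hI.eq_closedBall hx
  exact Metric.closedBall_subset_closedBall (by rw [dist_comm]; exact hy)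

/-- Seen from a point outside a ball, all points of the ball are at the same distance. -/
lemma IsBall.supBall_eq {I : Set X} (hI : IsBall I) {x y z : X} (hx : x ∉ I) (hy : y ∈ I)
    (hz : z ∈ I) : supBall x y = supBall x z := by
  have key : ∀ y ∈ I, ∀ z ∈ I, supBall x y ⊆ supBall x z := fun y hy z hz => by
    refine (isBall_supBall x z).supBall_subset (left_mem_supBall x z) ?_
    rcases hI.subset_or_subset (isBall_supBall x z) hz (right_mem_supBall x z) with h | h
    · exact h hy
    · exact absurd (h (left_mem_supBall x z)) hx
  exact (key y hy z hz).antisymm (key z hz y hy)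

/-- Balls that meet are nested, and by maximality of `C` no ball fits strictly between `C` and `J`.
-/
lemma IsMaxSubball.subset {C I J : Set X} (hC : IsMaxSubball C J) (hI : IsBall I) (hIJ : I ⊂ J)
    {x : X} (hxI : x ∈ I) (hxC : x ∈ C) : I ⊆ C := by
  rcases hI.subset_or_subset hC.1 hxI hxC with h | h
  · exact h
  · by_contra hn
    exact hIJ.ne (hC.2.2 I hI ⟨h, hn⟩ hIJ.subset)

lemma IsMaxSubball.eq_of_mem {C C' J : Set X} (hC : IsMaxSubball C J) (hC' : IsMaxSubball C' J)
    {x : X} (hx : x ∈ C) (hx' : x ∈ C') : C = C' :=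
  (hC'.subset hC.1 hC.2.1 hx hx').antisymm (hC.subset hC'.1 hC'.2.1 hx' hx)

/-- Distinct maximal subballs are disjoint, so the union defining `childContaining` has the single
member `C`. -/
lemma IsMaxSubball.childContaining_eq {C I J : Set X} (hC : IsMaxSubball C J) (hI : I.Nonempty)
    (hIC : I ⊆ C) : childContaining J I = C := by
  obtain ⟨x, hx⟩ := hI
  refine Subset.antisymm (sUnion_subset fun L hL => ?_) (subset_sUnion_of_mem ⟨hC, hIC⟩)
  exact (hL.1.eq_of_mem hC (hL.2 hx) (hIC hx)).subset

/-- A point outside the maximal subball of `J` around `x` is separated from `x` by `J`. -/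
lemma IsMaxSubball.supBall_eq {C J : Set X} (hJ : IsBall J) (hC : IsMaxSubball C J) {x y : X}
    (hx : x ∈ C) (hy : y ∈ J) (hyC : y ∉ C) : supBall x y = J := by
  by_contra hne
  have hss : supBall x y ⊂ J :=
    (hJ.supBall_subset (hC.2.1.subset hx) hy).ssubset_of_ne hne
  exact hyC (hC.subset (isBall_supBall x y) hss (left_mem_supBall x y) hx (right_mem_supBall x y))

namespace IsRegular

variable (hX : IsRegular X)
include hX

lemma exists_maxSubball_mem {J : Set X} (hJ : IsBall J) (hn : J.Nontrivial) {x : X} (hx : x ∈ J) :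
    ∃ C, IsMaxSubball C J ∧ x ∈ C := by
  rw [← (hX.finite_union J hJ hn).2] at hx
  exact hx

lemma exists_maxSubball_superset {I J : Set X} (hI : IsBall I) (hJ : IsBall J) (h : I ⊂ J) :
    ∃ C, IsMaxSubball C J ∧ I ⊆ C := by
  obtain ⟨x, hx⟩ := hI.nonempty
  obtain ⟨C, hC, hxC⟩ :=
    hX.exists_maxSubball_mem hJ (nontrivial_of_ssubset ⟨x, hx⟩ h) (h.subset hx)
  exact ⟨C, hC, hC.subset hI h hx hxC⟩

lemma isMaxSubball_childContaining {I J : Set X} (hI : IsBall I) (hJ : IsBall J) (h : I ⊂ J) :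
    IsMaxSubball (childContaining J I) J ∧ I ⊆ childContaining J I := by
  obtain ⟨C, hC, hIC⟩ := hX.exists_maxSubball_superset hI hJ h
  rw [hC.childContaining_eq hI.nonempty hIC]
  exact ⟨hC, hIC⟩

/-- If every ball with property `P` contains a smaller one, there are arbitrarily small ones,
forming a decreasing sequence. -/
lemma exists_seq_of_descent {P : Set X → Prop}
    (hstep : ∀ B, IsBall B → P B → ∃ B', IsBall B' ∧ B' ⊂ B ∧ P B') {A : Set X} (hA : IsBall A)
    (hPA : P A) : ∃ B : ℕ → Set X, (∀ k, IsBall (B k)) ∧ (∀ k, P (B k)) ∧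
      (∀ k, B (k + 1) ⊂ B k) ∧ Tendsto (fun k => Metric.diam (B k)) atTop (𝓝 0) := by
  choose! g hg1 hg2 hg3 using hstep
  have h : ∀ k, IsBall (g^[k] A) ∧ P (g^[k] A) := fun k => by
    induction k with
    | zero => exact ⟨hA, hPA⟩
    | succ k ih =>
      rw [Function.iterate_succ_apply']
      exact ⟨hg1 _ ih.1 ih.2, hg3 _ ih.1 ih.2⟩
  have hd : ∀ k, g^[k + 1] A ⊂ g^[k] A := fun k => by
    rw [Function.iterate_succ_apply']
    exact hg2 _ (h k).1 (h k).2
  exact ⟨fun k => g^[k] A, fun k => (h k).1, fun k => (h k).2, hd,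
    hX.diam_tendsto _ (fun k => (h k).1) hd⟩

/-- Induction along the path in the tree from an open ball `J` up to a larger ball. -/
lemma path_induction {J : Set X} (hJ : IsBall J) (hJo : IsOpen J) {Q : Set X → Prop} (h0 : Q J)
    (hstep : ∀ A C, IsBall A → IsMaxSubball C A → J ⊆ C → Q C → Q A) {A : Set X} (hA : IsBall A)
    (hJA : J ⊆ A) : Q A := by
  by_contra hQ
  -- Failure of `Q` passes from a ball to its maximal subball around `J`, which gives ever smaller
  -- bad balls containing `J`.
  obtain ⟨B, hB, hP, -, hlim⟩ := hX.exists_seq_of_descent (P := fun B => J ⊆ B ∧ ¬ Q B)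
    (fun B hB ⟨hJB, hQB⟩ => by
      have hss : J ⊂ B := hJB.ssubset_of_ne fun e => hQB (e ▸ h0)
      obtain ⟨C, hC, hJC⟩ := hX.exists_maxSubball_superset hJ hB hss
      exact ⟨C, hC.1, hC.2.1, hJC, fun h => hQB (hstep B C hB hC hJC h)⟩) hA ⟨hJA, hQ⟩
  obtain ⟨x, hx⟩ := hJ.nonempty
  obtain ⟨ε, hε, hball⟩ := Metric.isOpen_iff.1 hJo x hx
  obtain ⟨k, hk⟩ := (hlim.eventually (gt_mem_nhds hε)).exists
  refine (hP k).2 ?_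
  -- Since `J` is open, a ball around `x ∈ J` of diameter below `ε` lies in `J`; the bad ball is `J`
  -- itself, where `Q` holds.
  have : B k = J := Subset.antisymm (fun y hy => hball <|
    (Metric.dist_le_diam_of_mem (hB k).isBounded hy ((hP k).1 hx)).trans_lt hk) (hP k).1
  rwa [this]

/-- Each step of the path from `C` up to `A` adds only the ball `A`, since a smaller ball of `A`
around `J` already lies in `C`. -/
lemma finite_between {J : Set X} (hJ : IsBall J) (hJo : IsOpen J) {A : Set X} (hA : IsBall A)
    (hJA : J ⊆ A) : {B : Set X | IsBall B ∧ J ⊆ B ∧ B ⊆ A}.Finite := by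
  refine hX.path_induction hJ hJo (Q := fun A => {B : Set X | IsBall B ∧ J ⊆ B ∧ B ⊆ A}.Finite)
    ?_ (fun A C hA hC hJC h => ?_) hA hJA
  · exact (finite_singleton J).subset fun B hB => hB.2.2.antisymm hB.2.1
  · refine (h.insert A).subset fun B hB => ?_
    by_cases hBA : B = A
    · exact .inl hBA
    · obtain ⟨x, hx⟩ := hJ.nonempty
      exact .inr ⟨hB.1, hB.2.1,
        hC.subset hB.1 (hB.2.2.ssubset_of_ne hBA) (hB.2.1 hx) (hJC hx)⟩

end IsRegular

end Geometry

/-! ### One-dimensional wavelets as eigenfunctions. -/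

section Eigen

variable {X : Type*} [MetricSpace X]

lemma eq_zero_of_mem_ballSpace [MeasurableSpace X] {I : Set X} {g : X → ℂ} (hg : g ∈ ballSpace I)
    {x : X} (hx : x ∉ I) : g x = 0 := by
  induction hg using Submodule.span_induction with
  | mem g hg =>
    obtain ⟨J, hJ, rfl⟩ := hg
    exact indicator_of_notMem (fun h => hx (hJ.2.1.subset h)) _
  | zero => rfl
  | add f g _ _ hf hg => simp [hf, hg]
  | smul c f _ hf => simp [hf]

variable [IsUltrametricDist X]

lemma eq_of_mem_ballSpace [MeasurableSpace X] {I C : Set X} {g : X → ℂ} (hg : g ∈ ballSpace I)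
    (hC : IsMaxSubball C I) {x y : X} (hx : x ∈ C) (hy : y ∈ C) : g x = g y := by
  induction hg using Submodule.span_induction with
  | mem g hg =>
    obtain ⟨J, hJ, rfl⟩ := hg
    by_cases h : x ∈ J
    · have := hJ.eq_of_mem hC h hx
      subst this
      simp [chi, hx, hy]
    · have h' : y ∉ J := fun h' => h (by rwa [hJ.eq_of_mem hC h' hy])
      simp [chi, h, h']
  | zero => rfl
  | add f g _ _ hf hg => simp [hf, hg]
  | smul c f _ hf => simp [hf]

variable [MeasurableSpace X] [BorelSpace X]

lemma IsBall.measurableSet {I : Set X} (hI : IsBall I) : MeasurableSet I :=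
  hI.isClosed.measurableSet

variable [ProperSpace X] {ν : Measure X} [IsFiniteMeasureOnCompacts ν]

lemma IsBall.measure_ne_top {I : Set X} (hI : IsBall I) : ν I ≠ ⊤ :=
  hI.isCompact.measure_ne_top

lemma IsTest.integrable {φ : X → ℂ} (h : IsTest φ) : Integrable φ ν :=
  h.1.continuous.integrable_of_hasCompactSupport h.2

lemma integral_chi {I : Set X} (hI : IsBall I) : ∫ x, chi I x ∂ν = (ν.real I : ℂ) := by
  simp [chi, integral_indicator hI.measurableSet]

lemma IsMaxSubball.measureReal_sdiff {C J : Set X} (hC : IsMaxSubball C J) (hJ : IsBall J) :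
    ν.real (J \ C) = ν.real J - ν.real C :=
  MeasureTheory.measureReal_sdiff hC.2.1.subset hC.1.measurableSet hJ.measure_ne_top

namespace IsRegular

variable (hX : IsRegular X)
include hX

/-- The convergence condition on the kernel implies the convergence of the series for all
eigenvalues. -/
lemma summable_eigenvalue {K : Set X → ℂ} (hK : KernelConverges ν K) {I : Set X} (hI : IsBall I)
    (hIo : IsOpen I) : Summable fun J : {J : BigBall X // I ⊂ J.1} =>
      ‖K J.1.1‖ * (ν.real J.1.1 - ν.real (childContaining J.1.1 I)) := by
  obtain ⟨R, hR, hsum⟩ := hK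
  have : Nonempty X := hI.nonempty.to_type
  -- Strictly above `A` the balls `I` and `R` lie in the same maximal subball, so both series have
  -- the same terms there; only finitely many balls lie between `I` and `A`.
  obtain ⟨A, hA, hIRA⟩ := exists_isBall_superset (hI.isBounded.union hR.isBounded)
  obtain ⟨hIA, hRA⟩ := union_subset_iff.1 hIRA
  let F : Set X → BigBall X → ℝ := fun S J => ‖K J.1‖ * (ν.real J.1 - ν.real (childContaining J.1 S))
  have hR' : Summable ({J : BigBall X | R ⊂ J.1}.indicator (F R)) :=
    summable_subtype_iff_indicator.1 hsum
  refine summable_subtype_iff_indicator.2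
    ((summable_congr_cofinite (g := {J : BigBall X | I ⊂ J.1}.indicator (F I)) ?_).1
      (hR'.indicator {J : BigBall X | I ⊆ J.1}))
  have hfin : {J : BigBall X | I ⊆ J.1 ∧ J.1 ⊆ A}.Finite :=
    Finite.of_finite_image ((hX.finite_between hI hIo hA hIA).subset (by
      rintro _ ⟨J, hJ, rfl⟩
      exact ⟨J.2.1, hJ⟩)) Subtype.val_injective.injOn
  filter_upwards [hfin.compl_mem_cofinite] with J hJ
  by_cases hIJ : I ⊆ J.1
  · obtain ⟨x, hx⟩ := hI.nonempty
    have hAJ : A ⊂ J.1 := by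
      have hn : ¬ J.1 ⊆ A := fun h => hJ ⟨hIJ, h⟩
      exact ⟨(J.2.1.subset_or_subset hA (hIJ hx) (hIA hx)).resolve_left hn, hn⟩
    obtain ⟨C, hC, hAC⟩ := hX.exists_maxSubball_superset hA J.2.1 hAJ
    have h1 : R ⊂ J.1 := hRA.trans_ssubset hAJ
    have h2 : I ⊂ J.1 := hIA.trans_ssubset hAJ
    simp only [indicator, mem_ofPred_eq, hIJ, h1, h2, if_true, F,
      hC.childContaining_eq hI.nonempty (hIA.trans hAC),
      hC.childContaining_eq hR.nonempty (hRA.trans hAC)]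
  · have h2 : ¬ I ⊂ J.1 := fun h => hIJ h.subset
    simp [indicator, hIJ, h2]

/-- The complement of `I` is the countable disjoint union of the shells `J \ J(I)` over the balls `J
⊋ I`. For `x ∈ I` and `y` in such a shell `sup(x, y) = J`, so the kernel is constant on each shell.
-/
lemma integral_kernel_compl {K : Set X → ℂ} (hK : KernelConverges ν K) {I : Set X} (hI : IsBall I)
    (hIo : IsOpen I) {x : X} (hx : x ∈ I) :
    IntegrableOn (fun y => K (supBall x y)) Iᶜ ν ∧
      ∫ y in Iᶜ, K (supBall x y) ∂ν = ∑' J : {J : BigBall X // I ⊂ J.1},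
        K J.1.1 * ((ν.real J.1.1 - ν.real (childContaining J.1.1 I) : ℝ) : ℂ) := by
  have : Countable (BigBall X) := hX.countable_balls
  let s : {J : BigBall X // I ⊂ J.1} → Set X := fun J => J.1.1 \ childContaining J.1.1 I
  have hch := fun J : {J : BigBall X // I ⊂ J.1} =>
    hX.isMaxSubball_childContaining hI J.1.2.1 J.2
  have hsup : ∀ J, ∀ y ∈ s J, supBall x y = J.1.1 := fun J y hy =>
    (hch J).1.supBall_eq J.1.2.1 ((hch J).2 hx) hy.1 hy.2
  have hmeas : ∀ J, MeasurableSet (s J) := fun J =>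
    J.1.2.1.measurableSet.diff (hch J).1.1.measurableSet
  have hunion : Iᶜ = ⋃ J, s J := by
    ext y
    rw [mem_iUnion]
    constructor
    · intro hy
      have hss : I ⊂ supBall x y := by
        rcases hI.subset_or_subset (isBall_supBall x y) hx (left_mem_supBall x y) with h | h
        · exact h.ssubset_of_ne fun e => hy (e ▸ right_mem_supBall x y)
        · exact absurd (h (right_mem_supBall x y)) hy
      -- The shell of `y` belongs to `supBall x y`: a proper subball containing both `x` and `y`
      -- would contradict minimality.
      let J : {J : BigBall X // I ⊂ J.1} :=
        ⟨⟨supBall x y, isBall_supBall x y, nontrivial_of_ssubset ⟨x, hx⟩ hss⟩, hss⟩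
      refine ⟨J, right_mem_supBall x y, fun hyC => ?_⟩
      exact (hch J).1.2.1.not_subset
        ((hch J).1.1.supBall_subset ((hch J).2 hx) hyC)
    · rintro ⟨J, hy⟩ hyI
      exact hy.2 ((hch J).2 hyI)
  have hdisj : Pairwise (Function.onFun Disjoint s) := fun J J' hne =>
    disjoint_left.2 fun y hy hy' => hne <| Subtype.ext <| Subtype.ext <|
      (hsup J y hy).symm.trans (hsup J' y hy')
  have hfin : ∀ J, ν (s J) ≠ ⊤ := fun J =>
    measure_ne_top_of_subset sdiff_subset J.1.2.1.measure_ne_top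
  have hint : ∀ J, IntegrableOn (fun y => K (supBall x y)) (s J) ν := fun J =>
    (integrableOn_const (C := K J.1.1) (hfin J)).congr_fun
      (fun y hy => by simp only [hsup J y hy]) (hmeas J)
  have hreal : ∀ J, ν.real (s J) = ν.real J.1.1 - ν.real (childContaining J.1.1 I) := fun J =>
    (hch J).1.measureReal_sdiff J.1.2.1
  have hnorm : Summable fun J => ∫ y in s J, ‖K (supBall x y)‖ ∂ν := by
    refine (hX.summable_eigenvalue hK hI hIo).congr fun J => ?_
    rw [setIntegral_congr_fun (g := fun _ => ‖K J.1.1‖) (hmeas J)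
      (fun y hy => by simp only [hsup J y hy])]
    simp [hreal, mul_comm]
  have hIu : IntegrableOn (fun y => K (supBall x y)) (⋃ J, s J) ν :=
    integrableOn_iUnion_of_summable_integral_norm hint hnorm
  rw [hunion]
  refine ⟨hIu, ?_⟩
  rw [integral_iUnion hmeas hdisj hIu]
  refine tsum_congr fun J => ?_
  rw [setIntegral_congr_fun (g := fun _ => K J.1.1) (hmeas J)
      (fun y hy => by simp only [hsup J y hy])]
  simp [hreal, mul_comm]

/-- Wavelets are eigenfunctions of one-dimensional pseudodifferential operators. -/
lemma integral_kernel_wavelet {K : Set X → ℂ} (hK : KernelConverges ν K) {I : Set X}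
    (hI : IsBall I) (hIo : IsOpen I) {g : X → ℂ} (hg : g ∈ waveletSpace ν I) (x : X) :
    Integrable (fun y => K (supBall x y) * (g x - g y)) ν ∧
      ∫ y, K (supBall x y) * (g x - g y) ∂ν = eigenvalue₁ ν K I * g x := by
  have hgi : Integrable g ν := (isTest_of_mem_ballSpace hI hg.1).integrable
  by_cases hx : x ∈ I
  · obtain ⟨h1, h2⟩ := hX.integral_kernel_compl hK hI hIo hx
    -- Inside `I` the kernel may be replaced by `K I`: if `sup(x, y)` is smaller than `I`, then `x`
    -- and `y` share a maximal subball and `g x - g y = 0`.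
    have hin : EqOn (fun y => K (supBall x y) * (g x - g y)) (fun y => K I * (g x - g y)) I := by
      intro y hy
      rcases eq_or_ne (supBall x y) I with h | h
      · simp only [h]
      · obtain ⟨C, hC, hsub⟩ := hX.exists_maxSubball_superset (isBall_supBall x y) hI
          ((hI.supBall_subset hx hy).ssubset_of_ne h)
        simp [eq_of_mem_ballSpace hg.1 hC (hsub (left_mem_supBall x y))
          (hsub (right_mem_supBall x y))]
    have hout : EqOn (fun y => K (supBall x y) * (g x - g y)) (fun y => K (supBall x y) * g x)
        Iᶜ := fun y hy => by simp [eq_zero_of_mem_ballSpace hg.1 hy]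
    have hc : IntegrableOn (fun _ => g x) I ν := integrableOn_const hI.measure_ne_top
    have hi1 : IntegrableOn (fun y => K (supBall x y) * (g x - g y)) I ν :=
      IntegrableOn.congr_fun ((hc.sub hgi.integrableOn).const_mul (K I)) hin.symm hI.measurableSet
    have hi2 : IntegrableOn (fun y => K (supBall x y) * (g x - g y)) Iᶜ ν :=
      IntegrableOn.congr_fun (h1.mul_const (g x)) hout.symm hI.measurableSet.compl
    have hi : Integrable (fun y => K (supBall x y) * (g x - g y)) ν := by
      rw [← integrableOn_univ, ← union_compl_self I]
      exact hi1.union hi2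
    refine ⟨hi, ?_⟩
    have hg0 : ∫ y in I, g y ∂ν = 0 := by
      rw [setIntegral_eq_integral_of_forall_compl_eq_zero fun y hy =>
        eq_zero_of_mem_ballSpace hg.1 hy, hg.2]
    rw [← integral_add_compl hI.measurableSet hi, setIntegral_congr_fun hI.measurableSet hin,
      setIntegral_congr_fun hI.measurableSet.compl hout, integral_const_mul,
      integral_sub hc hgi.integrableOn, hg0, integral_mul_const, h2]
    simp only [eigenvalue₁, setIntegral_const, Complex.real_smul]
    ring
  · have hgx : g x = 0 := eq_zero_of_mem_ballSpace hg.1 hx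
    obtain ⟨z, hz⟩ := hI.nonempty
    -- Seen from `x ∉ I` the kernel is constant on the support of `g`, so the zero mean of `g` kills
    -- the integral.
    have : (fun y => K (supBall x y) * (g x - g y)) = fun y => -K (supBall x z) * g y := by
      funext y
      by_cases hy : y ∈ I
      · rw [hI.supBall_eq hx hy hz, hgx]
        ring
      · simp [hgx, eq_zero_of_mem_ballSpace hg.1 hy]
    rw [this, integral_const_mul, hg.2, hgx]
    exact ⟨hgi.const_mul _, by simp⟩

end IsRegular

end Eigen

/-! ### Wavelets and one characteristic function span the test functions. -/

section Span

variable {X : Type*} [MetricSpace X] [IsUltrametricDist X] [MeasurableSpace X] [BorelSpace X]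
  [ProperSpace X] {ν : Measure X} [IsFiniteMeasureOnCompacts ν]

lemma IsVertex.exists_bigBall {I : Set X} (h : IsVertex I) :
    ∃ J, IsBall J ∧ J.Nontrivial ∧ I ⊆ J := by
  obtain ⟨hI, hn | ⟨J, hJ, hn, hIJ⟩⟩ := h
  · exact ⟨I, hI, hn, Subset.rfl⟩
  · exact ⟨J, hJ, hn, hIJ.2.1.subset⟩

namespace IsRegular

variable (hX : IsRegular X)
include hX

lemma mul_chi_eq_sum {B : Set X} (hB : IsBall B) (hn : B.Nontrivial) (φ : X → ℂ) :
    φ * chi B = ∑ C ∈ (hX.finite_union B hB hn).1.toFinset, φ * chi C := by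
  funext x
  rw [Finset.sum_apply]
  by_cases hx : x ∈ B
  · obtain ⟨C, hC, hxC⟩ := hX.exists_maxSubball_mem hB hn hx
    rw [Finset.sum_eq_single C]
    · simp [chi, hx, hxC]
    · intro L hL hne
      have hxL : x ∉ L := fun h => hne (((Finite.mem_toFinset _).1 hL).eq_of_mem hC h hxC)
      simp [chi, hxL]
    · intro h
      exact absurd ((Finite.mem_toFinset (hX.finite_union B hB hn).1).2 hC) h
  · rw [Finset.sum_eq_zero fun L hL => ?_]
    · simp [chi, hx]
    · have hxL : x ∉ L := fun h => hx (((Finite.mem_toFinset _).1 hL).2.1.subset h)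
      simp [chi, hxL]

variable [ν.IsOpenPosMeasure]

/-- The characteristic functions of a vertex and of a larger ball are proportional modulo
wavelets. -/
lemma exists_chi_sub_mem {S : Submodule ℂ (X → ℂ)}
    (hS : ∀ I : BigBall X, waveletSpace ν I.1 ⊆ (S : Set (X → ℂ))) {J : Set X} (hJ : IsVertex J)
    {A : Set X} (hA : IsBall A) (hJA : J ⊆ A) :
    chi J - ((ν.real J / ν.real A : ℝ) : ℂ) • chi A ∈ S := by
  have hpos : ∀ B : Set X, IsBall B → J ⊆ B → ν.real B ≠ 0 := fun B hB hJB => by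
    refine (ENNReal.toReal_pos ?_ hB.measure_ne_top).ne'
    exact ((hJ.isOpen.measure_pos ν hJ.1.nonempty).trans_le (measure_mono hJB)).ne'
  refine hX.path_induction hJ.1 hJ.isOpen
    (Q := fun A => chi J - ((ν.real J / ν.real A : ℝ) : ℂ) • chi A ∈ S)
    ?_ (fun A C hA hC hJC h => ?_) hA hJA
  · simp [div_self (hpos J hJ.1 Subset.rfl)]
  · have hn : A.Nontrivial := nontrivial_of_ssubset hC.1.nonempty hC.2.1
    have hA0 := hpos A hA (hJC.trans hC.2.1.subset)
    have hC0 := hpos C hC.1 hJC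
    -- The coefficient `ν(C) / ν(A)` is the one that makes the mean vanish; the ratios then multiply
    -- along the path from `J` to `A`.
    have hw : chi C - ((ν.real C / ν.real A : ℝ) : ℂ) • chi A ∈ waveletSpace ν A := by
      refine ⟨sub_mem (Submodule.subset_span ⟨C, hC, rfl⟩) (Submodule.smul_mem _ _ ?_), ?_⟩
      · have := hX.mul_chi_eq_sum hA hn 1
        rw [one_mul] at this
        rw [this]
        refine sum_mem fun L hL => ?_
        rw [one_mul]
        exact Submodule.subset_span ⟨L, (Finite.mem_toFinset (hX.finite_union A hA hn).1).1 hL, rfl⟩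
      · have hiC : Integrable (chi C) ν := (isTest_chi hC.1 (hC.isOpen hA)).integrable
        have hiA : Integrable (chi A) ν :=
          (isTest_chi hA (IsVertex.isOpen ⟨hA, .inl hn⟩)).integrable
        simp only [Pi.sub_apply, Pi.smul_apply, smul_eq_mul]
        rw [integral_sub hiC (hiA.const_mul _), integral_const_mul, integral_chi hC.1,
          integral_chi hA, ← Complex.ofReal_mul, div_mul_cancel₀ _ hA0, sub_self]
    have h2 := S.add_mem h (S.smul_mem ((ν.real J / ν.real C : ℝ) : ℂ) (hS ⟨A, hA, hn⟩ hw))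
    convert h2 using 1
    have e : (ν.real J / ν.real A : ℝ) = ν.real J / ν.real C * (ν.real C / ν.real A) := by
      field_simp
    rw [smul_sub, smul_smul, ← Complex.ofReal_mul, ← e]
    abel

/-- The wavelets and one characteristic function of a vertex generate all test functions. -/
lemma isTest_mem {S : Submodule ℂ (X → ℂ)}
    (hS : ∀ I : BigBall X, waveletSpace ν I.1 ⊆ (S : Set (X → ℂ))) {I₀ : Set X} (hI₀ : IsVertex I₀)
    (h0 : chi I₀ ∈ S) {φ : X → ℂ} (hφ : IsTest φ) : φ ∈ S := by
  have : Nonempty X := hI₀.1.nonempty.to_type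
  -- Modulo `S`, both `χ_{I₀}` and `χ_J` are nonzero multiples of `χ_A` for a common ball `A`, so
  -- `χ_{I₀} ∈ S` forces `χ_A ∈ S` and then `χ_J ∈ S`.
  have hchi : ∀ J, IsVertex J → chi J ∈ S := fun J hJ => by
    obtain ⟨A, hA, hsub⟩ := exists_isBall_superset (hI₀.1.isBounded.union hJ.1.isBounded)
    obtain ⟨hIA, hJA⟩ := union_subset_iff.1 hsub
    have h1 := hX.exists_chi_sub_mem hS hI₀ hA hIA
    have h2 := hX.exists_chi_sub_mem hS hJ hA hJA
    have hI0 : ν.real I₀ ≠ 0 := (ENNReal.toReal_pos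
      (hI₀.isOpen.measure_pos ν hI₀.1.nonempty).ne' hI₀.1.measure_ne_top).ne'
    have hA0 : ν.real A ≠ 0 := (ENNReal.toReal_pos
      ((hI₀.isOpen.measure_pos ν hI₀.1.nonempty).trans_le (measure_mono hIA)).ne'
      hA.measure_ne_top).ne'
    have hc : ((ν.real I₀ / ν.real A : ℝ) : ℂ) ≠ 0 := by
      exact_mod_cast div_ne_zero hI0 hA0
    have hA' : chi A ∈ S := by
      have h3 := S.sub_mem h0 h1
      rw [sub_sub_cancel] at h3
      exact (S.smul_mem_iff hc).1 h3
    have h4 := S.add_mem h2 (S.smul_mem ((ν.real J / ν.real A : ℝ) : ℂ) hA')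
    rwa [sub_add_cancel] at h4
  -- Including `Q` makes `A` a ball of nonzero diameter, hence a vertex at which the descent can
  -- start.
  obtain ⟨Q, hQ, hQn, -⟩ := hI₀.exists_bigBall
  obtain ⟨A, hA, hsub⟩ := exists_isBall_superset (hQ.isBounded.union hφ.2.isBounded)
  obtain ⟨hQA, hφA⟩ := union_subset_iff.1 hsub
  have hAφ : φ * chi A = φ := by
    funext x
    by_cases hx : x ∈ A
    · simp [chi, hx]
    · have : φ x = 0 := image_eq_zero_of_notMem_tsupport fun h => hx (hφA h)
      simp [this]
  rw [← hAφ]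
  by_contra hn
  -- If `φ χ_B ∉ S`, then `B` is not a point, and some maximal subball `C` of `B` has `φ χ_C ∉ S`,
  -- since `φ χ_B` is the sum of these.
  obtain ⟨B, hB, hP, hdec, hlim⟩ := hX.exists_seq_of_descent
    (P := fun B => IsVertex B ∧ φ * chi B ∉ S) (fun B hB ⟨hv, hBS⟩ => by
      have hnt : B.Nontrivial := by
        by_contra hnt
        obtain ⟨x, hx⟩ := hB.nonempty
        refine hBS ?_
        have : φ * chi B = φ x • chi B := by
          funext y
          by_cases hy : y ∈ B
          · simp [not_nontrivial_iff.1 hnt hy hx]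
          · simp [chi, hy]
        rw [this]
        exact S.smul_mem _ (hchi B hv)
      by_contra hcon
      push Not at hcon
      refine hBS ?_
      rw [hX.mul_chi_eq_sum hB hnt]
      refine sum_mem fun C hC => ?_
      rw [Finite.mem_toFinset] at hC
      exact hcon C hC.1 hC.2.1 (hC.isVertex hB hnt))
    hA ⟨⟨hA, .inl (hQn.mono hQA)⟩, hn⟩
  -- By compactness the bad balls share a point `x`. Near `x` the function `φ` is constant, so for
  -- small `B k` the product is a multiple of `χ_{B k}`, a contradiction.
  obtain ⟨x, hx⟩ := IsCompact.nonempty_iInter_of_sequence_nonempty_isCompact_isClosed B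
    (fun k => (hdec k).subset) (fun k => (hB k).nonempty) (hB 0).isCompact
    (fun k => (hB k).isClosed)
  rw [mem_iInter] at hx
  obtain ⟨U, hU, hxU, hφU⟩ := (IsLocallyConstant.iff_exists_open φ).1 hφ.1 x
  obtain ⟨ε, hε, hball⟩ := Metric.isOpen_iff.1 hU x hxU
  obtain ⟨k, hk⟩ := (hlim.eventually (gt_mem_nhds hε)).exists
  refine (hP k).2 ?_
  have : φ * chi (B k) = φ x • chi (B k) := by
    funext y
    by_cases hy : y ∈ B k
    · have : φ y = φ x := hφU y (hball
        ((Metric.dist_le_diam_of_mem (hB k).isBounded hy (hx k)).trans_lt hk))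
      simp [this]
    · simp [chi, hy]
  rw [this]
  exact S.smul_mem _ (hchi _ (hP k).1)

end IsRegular

end Span

/-! ### Conjugate wavelets, orthogonality and biorthogonality. -/

section Wavelets

variable {X : Type*} [MetricSpace X] [IsUltrametricDist X] [MeasurableSpace X] [BorelSpace X]
  [ProperSpace X] {ν : Measure X} [IsFiniteMeasureOnCompacts ν]

lemma isTest_psi₁ (W : Wavelets ν) (I₀ : Vertex X) (p : Option (WIdx X)) :
    IsTest (psi₁ W I₀ p) := by
  rcases p with _ | p
  · exact isTest_chi I₀.2.1 I₀.2.isOpen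
  · exact W.isTest p

lemma conj_mem_waveletSpace {I : Set X} {g : X → ℂ} (hg : g ∈ waveletSpace ν I) :
    (fun x => conj (g x)) ∈ waveletSpace ν I := by
  refine ⟨?_, by rw [integral_conj, hg.2, map_zero]⟩
  replace hg := hg.1
  induction hg using Submodule.span_induction with
  | mem g h =>
    obtain ⟨J, hJ, rfl⟩ := h
    refine Submodule.subset_span ⟨J, hJ, ?_⟩
    funext x
    by_cases hx : x ∈ J <;> simp [chi, hx]
  | zero =>
    simp only [Pi.zero_apply, map_zero]
    exact (ballSpace I).zero_mem
  | add f g _ _ hf hg =>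
    simp only [Pi.add_apply, map_add]
    exact (ballSpace I).add_mem hf hg
  | smul c f _ hf =>
    simp only [Pi.smul_apply, smul_eq_mul, map_mul]
    exact (ballSpace I).smul_mem _ hf

/-- `V⁰(I)` is stable under conjugation: expand `conj g` in the wavelets and conjugate the
expansion. -/
lemma Wavelets.waveletSpace_subset_span_conj (W : Wavelets ν) (I : BigBall X) :
    waveletSpace ν I.1 ⊆ (Submodule.span ℂ (range fun (p : WIdx X) x => conj (W.fn p.1 p.2 x)) :
      Set (X → ℂ)) := by
  intro g hg
  have key : ∀ h ∈ Submodule.span ℂ (range (W.fn I)), (fun x => conj (h x)) ∈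
      Submodule.span ℂ (range fun (p : WIdx X) x => conj (W.fn p.1 p.2 x)) := fun h hh => by
    induction hh using Submodule.span_induction with
    | mem h hh =>
      obtain ⟨j, rfl⟩ := hh
      exact Submodule.subset_span ⟨⟨I, j⟩, rfl⟩
    | zero =>
      simp only [Pi.zero_apply, map_zero]
      exact Submodule.zero_mem _
    | add f g _ _ hf hg =>
      simp only [Pi.add_apply, map_add]
      exact Submodule.add_mem _ hf hg
    | smul c f _ hf =>
      simp only [Pi.smul_apply, smul_eq_mul, map_mul]
      exact Submodule.smul_mem _ (conj c) hf
  have h2 := key (fun x => conj (g x)) (by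
    have := conj_mem_waveletSpace hg
    rw [← W.span_eq] at this
    exact this)
  simpa using h2

/-- The conjugate functions `Ψ_{Ij}` generate all test functions. -/
lemma IsRegular.isTest_mem_span_conj [ν.IsOpenPosMeasure] (hX : IsRegular X) (W : Wavelets ν)
    (I₀ : Vertex X) {φ : X → ℂ} (hφ : IsTest φ) :
    φ ∈ Submodule.span ℂ (range fun p x => conj (psi₁ W I₀ p x)) := by
  refine hX.isTest_mem (ν := ν) (fun I => ?_) I₀.2 ?_ hφ
  · refine (W.waveletSpace_subset_span_conj I).trans (Submodule.span_mono ?_)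
    rintro _ ⟨p, rfl⟩
    exact ⟨some p, rfl⟩
  · refine Submodule.subset_span ⟨none, ?_⟩
    funext x
    by_cases hx : x ∈ I₀.1 <;> simp [psi₁, chi, hx]

/-- The conjugate wavelets generate all test functions with zero mean. -/
lemma IsRegular.isTestZero_mem_span_conj [ν.IsOpenPosMeasure] (hX : IsRegular X) (W : Wavelets ν)
    (I₀ : Vertex X) {φ : X → ℂ} (hφ : IsTestZero ν φ) :
    φ ∈ Submodule.span ℂ (range fun (p : WIdx X) x => conj (W.fn p.1 p.2 x)) := by
  set D := Submodule.span ℂ (range fun (p : WIdx X) x => conj (W.fn p.1 p.2 x))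
  have hD : ∀ g ∈ D, Integrable g ν ∧ ∫ x, g x ∂ν = 0 := fun g hg => by
    induction hg using Submodule.span_induction with
    | mem g hg =>
      obtain ⟨p, rfl⟩ := hg
      exact ⟨(W.isTest p).conj.integrable, by rw [integral_conj, (W.mem p).2, map_zero]⟩
    | zero => exact ⟨integrable_zero _ _ _, by simp⟩
    | add f g _ _ hf hg => exact ⟨hf.1.add hg.1, by
        simp only [Pi.add_apply]
        rw [integral_add hf.1 hg.1, hf.2, hg.2, add_zero]⟩
    | smul c f _ hf => exact ⟨hf.1.smul c, by
        simp only [Pi.smul_apply]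
        rw [integral_smul, hf.2, smul_zero]⟩
  -- Everything in `D` has zero mean and `χ_{I₀}` has not, so the zero mean of `φ` removes the
  -- `χ_{I₀}` component.
  have hmem : φ ∈ D ⊔ Submodule.span ℂ {chi I₀.1} :=
    hX.isTest_mem (ν := ν) (fun I => (W.waveletSpace_subset_span_conj I).trans
      (SetLike.coe_subset_coe.2 le_sup_left)) I₀.2
      (Submodule.mem_sup_right (Submodule.mem_span_singleton_self _)) hφ.1
  obtain ⟨d, hd, e, he, rfl⟩ := Submodule.mem_sup.1 hmem
  obtain ⟨c, rfl⟩ := Submodule.mem_span_singleton.1 he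
  have h0 := hφ.2
  have hchi : Integrable (chi I₀.1) ν := (isTest_chi I₀.2.1 I₀.2.isOpen).integrable
  simp only [Pi.add_apply, Pi.smul_apply, smul_eq_mul] at h0
  rw [integral_add (hD d hd).1 (hchi.const_mul c), (hD d hd).2, integral_const_mul,
    integral_chi I₀.2.1, zero_add] at h0
  have hpos : ν.real I₀.1 ≠ 0 := (ENNReal.toReal_pos
      (I₀.2.isOpen.measure_pos ν I₀.2.1.nonempty).ne' I₀.2.1.measure_ne_top).ne'
  have hc : c = 0 := (mul_eq_zero.1 h0).resolve_right (by exact_mod_cast hpos)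
  simpa [hc] using hd

/-- The ball `I` lies in one maximal subball of `J`, where `g` is constant; the product is a
multiple of `f`, which has zero mean. -/
lemma IsRegular.integral_mul_of_ssubset (hX : IsRegular X) {I J : Set X} (hI : IsBall I)
    (hJ : IsBall J) (h : I ⊂ J) {f g : X → ℂ} (hf : f ∈ waveletSpace ν I) (hg : g ∈ ballSpace J) :
    ∫ x, f x * g x ∂ν = 0 := by
  obtain ⟨C, hC, hIC⟩ := hX.exists_maxSubball_superset hI hJ h
  obtain ⟨z, hz⟩ := hI.nonempty
  have : (fun x => f x * g x) = fun x => f x * g z := by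
    funext x
    by_cases hx : x ∈ I
    · rw [eq_of_mem_ballSpace hg hC (hIC hx) (hIC hz)]
    · simp [eq_zero_of_mem_ballSpace hf.1 hx]
  rw [this, integral_mul_const, hf.2, zero_mul]

/-- Wavelets of different balls are orthogonal. -/
lemma IsRegular.integral_mul_eq_zero (hX : IsRegular X) {I J : Set X} (hI : IsBall I)
    (hJ : IsBall J) (h : I ≠ J) {f g : X → ℂ} (hf : f ∈ waveletSpace ν I)
    (hg : g ∈ waveletSpace ν J) : ∫ x, f x * g x ∂ν = 0 := by
  by_cases hd : ∃ x, x ∈ I ∧ x ∈ J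
  · obtain ⟨x, hxI, hxJ⟩ := hd
    rcases hI.subset_or_subset hJ hxI hxJ with hs | hs
    · exact hX.integral_mul_of_ssubset hI hJ (hs.ssubset_of_ne h) hf hg.1
    · simp only [mul_comm (f _)]
      exact hX.integral_mul_of_ssubset hJ hI (hs.ssubset_of_ne h.symm) hg hf.1
  · push Not at hd
    have : ∀ x, f x * g x = 0 := fun x => by
      by_cases hx : x ∈ I
      · simp [eq_zero_of_mem_ballSpace hg.1 (hd x hx)]
      · simp [eq_zero_of_mem_ballSpace hf.1 hx]
    simp [this]

lemma IsRegular.integral_wavelet_mul_conj [DecidableEq (WIdx X)] (hX : IsRegular X)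
    (W : Wavelets ν) (p q : WIdx X) :
    ∫ x, W.fn p.1 p.2 x * conj (W.fn q.1 q.2 x) ∂ν = if p = q then 1 else 0 := by
  obtain ⟨I, j⟩ := p
  obtain ⟨J, k⟩ := q
  by_cases h : I = J
  · subst h
    have := W.orthonormal I k j
    simp only [mul_comm (conj _)] at this
    rw [this]
    simp [eq_comm]
  · rw [hX.integral_mul_eq_zero I.2.1 J.2.1 (fun e => h (Subtype.ext e)) (W.mem ⟨I, j⟩)
      (conj_mem_waveletSpace (W.mem ⟨J, k⟩)), if_neg (by simp [h])]

/-- The measure of `I₀` for the index `none`, and `1` for the indices of wavelets. -/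
noncomputable def dualWeight (ν : Measure X) (I₀ : Vertex X) : Option (WIdx X) → ℂ
  | none => (ν.real I₀.1 : ℂ)
  | some _ => 1

/-- The factors of the series are biorthogonal to the functions `Ψ_{Ij}`. -/
lemma IsRegular.integral_seriesFactor_mul_conj [DecidableEq (Option (WIdx X))]
    [ν.IsOpenPosMeasure] (hX : IsRegular X) (W : Wavelets ν) (I₀ : Vertex X)
    (p q : Option (WIdx X)) :
    Integrable (fun x => seriesFactor W I₀ p x * conj (psi₁ W I₀ q x)) ν ∧
      ∫ x, seriesFactor W I₀ p x * conj (psi₁ W I₀ q x) ∂ν =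
        if p = q then dualWeight ν I₀ p else 0 := by
  classical
  have hpos : (ν.real I₀.1 : ℂ) ≠ 0 := by
    exact_mod_cast (ENNReal.toReal_pos
      (I₀.2.isOpen.measure_pos ν I₀.2.1.nonempty).ne' I₀.2.1.measure_ne_top).ne'
  have hq : Integrable (fun x => conj (psi₁ W I₀ q x)) ν := (isTest_psi₁ W I₀ q).conj.integrable
  have hint : ∫ x, conj (psi₁ W I₀ q x) ∂ν = if q = none then (ν.real I₀.1 : ℂ) else 0 := by
    rw [integral_conj]
    rcases q with _ | q
    · simp [psi₁, integral_chi I₀.2.1]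
    · simp [psi₁, (W.mem q).2]
  rcases p with _ | p
  · simp only [seriesFactor, one_mul]
    refine ⟨hq, ?_⟩
    rw [hint]
    simp [dualWeight, eq_comm]
  · simp only [seriesFactor, sub_mul]
    have hpq : Integrable (fun x => W.fn p.1 p.2 x * conj (psi₁ W I₀ q x)) ν := by
      have : IsTest (fun x => W.fn p.1 p.2 x * conj (psi₁ W I₀ q x)) :=
        ⟨(W.isTest p).1.mul (isTest_psi₁ W I₀ q).conj.1, (W.isTest p).2.mul_right⟩
      exact this.integrable
    refine ⟨hpq.sub (hq.const_mul _), ?_⟩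
    rw [integral_sub hpq (hq.const_mul _), integral_const_mul, hint]
    -- Against `χ_{I₀}` the subtracted constant cancels the pairing exactly; against a wavelet it
    -- contributes nothing, the mean being zero.
    rcases q with _ | q
    · have hc : ∀ x, conj (chi I₀.1 x) = chi I₀.1 x := fun x => by
        by_cases hx : x ∈ I₀.1 <;> simp [chi, hx]
      simp only [psi₁, hc]
      simp [mul_right_comm, hpos]
    · have := hX.integral_wavelet_mul_conj W p q
      simp only [psi₁, this]
      simp [dualWeight]

end Wavelets

/-! ### Spans of product functions. -/

section Products

/-- A product of finite sums expands into a sum over all choices of one term per factor. -/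
lemma prod_mem_span {ι : Type*} [Fintype ι] {X κ : ι → Type*} (b : ∀ i, κ i → X i → ℂ)
    {φ : ∀ i, X i → ℂ} (hφ : ∀ i, φ i ∈ Submodule.span ℂ (range (b i))) :
    (fun x : ∀ i, X i => ∏ i, φ i (x i)) ∈
      Submodule.span ℂ (range fun (α : ∀ i, κ i) (x : ∀ i, X i) => ∏ i, b i (α i) (x i)) := by
  classical
  have h : ∀ i, ∃ c : κ i →₀ ℂ, ∑ p ∈ c.support, c p • b i p = φ i := fun i => by
    obtain ⟨c, hc⟩ := Finsupp.mem_span_range_iff_exists_finsupp.1 (hφ i)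
    exact ⟨c, hc⟩
  choose c hc using h
  have : (fun x : ∀ i, X i => ∏ i, φ i (x i)) =
      ∑ α ∈ Fintype.piFinset fun i => (c i).support,
        (∏ i, c i (α i)) • fun x : ∀ i, X i => ∏ i, b i (α i) (x i) := by
    funext x
    simp only [← hc, Finset.sum_apply, Pi.smul_apply, smul_eq_mul, Finset.prod_univ_sum,
      Finset.prod_mul_distrib]
  rw [this]
  exact sum_mem fun α _ => Submodule.smul_mem _ _ (Submodule.subset_span ⟨α, rfl⟩)

lemma top_le_span_range_of_coe {M ι : Type*} [AddCommGroup M] [Module ℂ M] {S : Submodule ℂ M}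
    {v : ι → S} (h : S ≤ Submodule.span ℂ (range fun i => (v i : M))) :
    ⊤ ≤ Submodule.span ℂ (range v) := by
  rintro ⟨F, hF⟩ -
  have hF' := h hF
  rw [show (range fun i => (v i : M)) = S.subtype '' range v from (range_comp S.subtype v),
    Submodule.span_image] at hF'
  obtain ⟨y, hy, hyF⟩ := hF'
  rwa [show (⟨F, hF⟩ : S) = y from Subtype.ext hyF.symm]

end Products

/-! ### Diagonal form of the operator and the basis of test functions. -/

section MultiDim

variable {n : ℕ} {X : Fin n → Type*} [∀ i, MetricSpace (X i)] [∀ i, IsUltrametricDist (X i)]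
  [∀ i, ProperSpace (X i)] [∀ i, MeasurableSpace (X i)] [∀ i, BorelSpace (X i)]
  {ν : ∀ i, Measure (X i)} [∀ i, IsFiniteMeasureOnCompacts (ν i)]

section Operators

variable (hX : ∀ i, IsRegular (X i)) {K : ∀ i, Set (X i) → ℂ}
  (hK : ∀ i, KernelConverges (ν i) (K i)) {g : ∀ i, WIdx (X i) → X i → ℂ}
  (hg : ∀ i p, g i p ∈ waveletSpace (ν i) p.1.1)
include hX hK hg

/-- The operator is an integral, additive only under integrability, which is known for each product
of wavelets; hence the form with finite sums. The family `g` is general so that it covers wavelets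
and their conjugates. -/
lemma pdo₁_sum (s : Finset (MWIdx X)) (c : MWIdx X → ℂ) (i : Fin n) :
    pdo₁ ν K i (∑ β ∈ s, c β • fun x : ∀ i, X i => ∏ j, g j (β j) (x j)) =
      ∑ β ∈ s, (c β * eigenvalue₁ (ν i) (K i) (β i).1.1) •
        fun x : ∀ i, X i => ∏ j, g j (β j) (x j) := by
  classical
  funext x
  -- The product of the factors other than the `i`-th, unaffected by changing the `i`-th coordinate.
  let R : MWIdx X → ℂ := fun β => ∏ j ∈ Finset.univ.erase i, g j (β j) (x j)
  have h1 : ∀ β : MWIdx X, ∏ j, g j (β j) (x j) = g i (β i) (x i) * R β := fun β =>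
    (Finset.mul_prod_erase Finset.univ (fun j => g j (β j) (x j)) (Finset.mem_univ i)).symm
  have h2 : ∀ (β : MWIdx X) (y : X i),
      ∏ j, g j (β j) (Function.update x i y j) = g i (β i) y * R β := fun β y => by
    rw [← Finset.mul_prod_erase Finset.univ _ (Finset.mem_univ i), Function.update_self]
    congr 1
    refine Finset.prod_congr rfl fun j hj => ?_
    rw [Function.update_of_ne (Finset.ne_of_mem_erase hj)]
  have hw := fun β : MWIdx X => (hX i).integral_kernel_wavelet (hK i) (β i).1.2.1
    (IsVertex.isOpen ⟨(β i).1.2.1, .inl (β i).1.2.2⟩) (hg i (β i)) (x i)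
  simp only [pdo₁, Finset.sum_apply, Pi.smul_apply, smul_eq_mul, h1, h2]
  have h3 : ∀ y, K i (supBall (x i) y) * (∑ β ∈ s, c β * (g i (β i) (x i) * R β) -
      ∑ β ∈ s, c β * (g i (β i) y * R β)) = ∑ β ∈ s, (c β * R β) *
        (K i (supBall (x i) y) * (g i (β i) (x i) - g i (β i) y)) := fun y => by
    rw [← Finset.sum_sub_distrib, Finset.mul_sum]
    exact Finset.sum_congr rfl fun β _ => by ring
  simp only [h3]
  rw [integral_finsetSum _ fun β _ => (hw β).1.const_mul _]
  refine Finset.sum_congr rfl fun β _ => ?_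
  rw [integral_const_mul, (hw β).2]
  ring

lemma foldr_pdo₁_sum (l : List (Fin n)) (s : Finset (MWIdx X)) (c : MWIdx X → ℂ) :
    l.foldr (pdo₁ ν K) (∑ β ∈ s, c β • fun x : ∀ i, X i => ∏ j, g j (β j) (x j)) =
      ∑ β ∈ s, (c β * (l.map fun i => eigenvalue₁ (ν i) (K i) (β i).1.1).prod) •
        fun x : ∀ i, X i => ∏ j, g j (β j) (x j) := by
  induction l with
  | nil => simp
  | cons i l ih =>
    rw [List.foldr_cons, ih, pdo₁_sum hX hK hg]
    refine Finset.sum_congr rfl fun β _ => ?_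
    rw [List.map_cons, List.prod_cons]
    congr 1
    ring

lemma pdo_sum (m : ℕ) (a : (k : ℕ) → (Fin k → Fin n) → ℂ) (s : Finset (MWIdx X))
    (c : MWIdx X → ℂ) :
    pdo ν K m a (∑ β ∈ s, c β • fun x : ∀ i, X i => ∏ j, g j (β j) (x j)) =
      ∑ β ∈ s, (c β * eigenvalue ν K m a β.ball) •
        fun x : ∀ i, X i => ∏ j, g j (β j) (x j) := by
  funext x
  simp only [pdo, foldr_pdo₁_sum hX hK hg, Finset.sum_apply, Pi.smul_apply, smul_eq_mul,
    eigenvalue, Finset.mul_sum, Finset.sum_mul, List.map_ofFn, List.prod_ofFn]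
  rw [Finset.sum_comm (s := s)]
  refine Finset.sum_congr rfl fun k _ => ?_
  rw [Finset.sum_comm (s := s)]
  refine Finset.sum_congr rfl fun t _ => Finset.sum_congr rfl fun β _ => ?_
  simp only [Function.comp_apply, MWIdx.ball]
  ring

/-- Products of one-dimensional wavelets are eigenfunctions. -/
lemma pdo_prod (m : ℕ) (a : (k : ℕ) → (Fin k → Fin n) → ℂ) (β : MWIdx X) :
    pdo ν K m a (fun x : ∀ i, X i => ∏ j, g j (β j) (x j)) =
      eigenvalue ν K m a β.ball • fun x : ∀ i, X i => ∏ j, g j (β j) (x j) := by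
  simpa using pdo_sum hX hK hg m a {β} 1

end Operators

variable (W : ∀ i, Wavelets (ν i)) (I₀ : ∀ i, Vertex (X i))

lemma conjPsi_apply (α : MIdx X) :
    (conjPsi W I₀ α).1 = fun x => ∏ i, conj (psi₁ (W i) (I₀ i) (α i) (x i)) := by
  funext x
  simp [conjPsi, psi, map_prod]

lemma conjWavelet_apply (β : MWIdx X) :
    (conjWavelet W β).1 = fun x => ∏ i, conj ((W i).fn (β i).1 (β i).2 (x i)) := by
  funext x
  simp [conjWavelet, wavelet, map_prod]

lemma conjPsi_toMIdx (β : MWIdx X) : (conjPsi W I₀ β.toMIdx).1 = (conjWavelet W β).1 := by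
  rw [conjPsi_apply, conjWavelet_apply]
  rfl

/-- The value of the series term with index `α` on `conj Ψ_α`. -/
noncomputable def totalWeight (ν : ∀ i, Measure (X i)) (I₀ : ∀ i, Vertex (X i)) (α : MIdx X) : ℂ :=
  ∏ i, dualWeight (ν i) (I₀ i) (α i)

lemma totalWeight_eq (α : MIdx X) :
    totalWeight ν I₀ α = ∏ i with α i = none, ((ν i).real (I₀ i).1 : ℂ) := by
  rw [Finset.prod_filter, totalWeight]
  refine Finset.prod_congr rfl fun i _ => ?_
  cases h : α i <;> simp [dualWeight]

lemma totalWeight_toMIdx (β : MWIdx X) : totalWeight ν I₀ β.toMIdx = 1 :=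
  Finset.prod_eq_one fun _ _ => rfl

variable [∀ i, (ν i).IsOpenPosMeasure]

lemma totalWeight_ne_zero (α : MIdx X) : totalWeight ν I₀ α ≠ 0 := by
  rw [totalWeight_eq]
  refine Finset.prod_ne_zero_iff.2 fun i _ => ?_
  exact_mod_cast (ENNReal.toReal_pos ((I₀ i).2.isOpen.measure_pos (ν i) (I₀ i).2.1.nonempty).ne'
    (I₀ i).2.1.measure_ne_top).ne'

variable (hX : ∀ i, IsRegular (X i))
include hX

lemma integral_series_mul_conjPsi [DecidableEq (MIdx X)] (α β : MIdx X) :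
    Integrable (fun x => (∏ i, seriesFactor (W i) (I₀ i) (α i) (x i)) * (conjPsi W I₀ β).1 x)
        (Measure.pi ν) ∧
      ∫ x, (∏ i, seriesFactor (W i) (I₀ i) (α i) (x i)) * (conjPsi W I₀ β).1 x ∂(Measure.pi ν) =
        if α = β then totalWeight ν I₀ α else 0 := by
  classical
  simp only [conjPsi_apply, ← Finset.prod_mul_distrib]
  have h := fun i => (hX i).integral_seriesFactor_mul_conj (W i) (I₀ i) (α i) (β i)
  refine ⟨Integrable.fintype_prod_dep fun i => (h i).1, ?_⟩
  rw [integral_fintype_prod_eq_prod fun i y =>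
    seriesFactor (W i) (I₀ i) (α i) y * conj (psi₁ (W i) (I₀ i) (β i) y)]
  simp only [(h _).2]
  split_ifs with hαβ
  · subst hαβ
    simp [totalWeight]
  · obtain ⟨i, hi⟩ := Function.ne_iff.1 hαβ
    exact Finset.prod_eq_zero (Finset.mem_univ i) (if_neg hi)

/-- Biorthogonality turns each series term into a weighted coordinate functional; linear
independence and the series formula both come from this. -/
lemma seriesTerm_linearCombination (α : MIdx X) (c : MIdx X →₀ ℂ) :
    seriesTerm W I₀ α (Finsupp.linearCombination ℂ (conjPsi W I₀) c).1 =
      c α * totalWeight ν I₀ α := by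
  classical
  have h := integral_series_mul_conjPsi W I₀ hX α
  simp only [seriesTerm, Finsupp.linearCombination_apply, Finsupp.sum, Submodule.coe_sum,
    Submodule.coe_smul, Finset.sum_apply, Pi.smul_apply, smul_eq_mul, Finset.mul_sum,
    mul_left_comm _ (c _)]
  rw [integral_finsetSum _ fun β _ => (h β).1.const_mul _]
  simp only [integral_const_mul, (h _).2]
  simp +contextual [Finset.sum_ite_eq]

lemma linearIndependent_conjPsi : LinearIndependent ℂ (conjPsi W I₀) := by
  rw [linearIndependent_iff]
  intro c hc
  ext α
  have h := seriesTerm_linearCombination W I₀ hX α c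
  rw [hc] at h
  simp only [seriesTerm, Submodule.coe_zero, Pi.zero_apply, mul_zero, integral_zero] at h
  exact (mul_eq_zero.1 h.symm).resolve_right (totalWeight_ne_zero I₀ α)

lemma top_le_span_conjPsi : ⊤ ≤ Submodule.span ℂ (range (conjPsi W I₀)) := by
  refine top_le_span_range_of_coe ?_
  simp only [conjPsi_apply]
  refine Submodule.span_le.2 ?_
  rintro _ ⟨φ, hφ, rfl⟩
  exact prod_mem_span (fun i p x => conj (psi₁ (W i) (I₀ i) p x)) fun i =>
    (hX i).isTest_mem_span_conj (W i) (I₀ i) (hφ i)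

include I₀ in
lemma top_le_span_conjWavelet : ⊤ ≤ Submodule.span ℂ (range (conjWavelet W)) := by
  refine top_le_span_range_of_coe ?_
  simp only [conjWavelet_apply]
  refine Submodule.span_le.2 ?_
  rintro _ ⟨φ, hφ, rfl⟩
  exact prod_mem_span (fun i (p : WIdx (X i)) x => conj ((W i).fn p.1 p.2 x)) fun i =>
    (hX i).isTestZero_mem_span_conj (W i) (I₀ i) (hφ i)

/-- The functions `conj Ψ_{Ij}` form a basis of the space of test functions. -/
noncomputable def conjPsiBasis : Module.Basis (MIdx X) ℂ (TestSpace X) :=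
  .mk (linearIndependent_conjPsi W I₀ hX) (top_le_span_conjPsi W I₀ hX)

lemma conjPsiBasis_apply (α : MIdx X) : conjPsiBasis W I₀ hX α = conjPsi W I₀ α := by
  simp [conjPsiBasis]

lemma seriesTerm_eq_repr (α : MIdx X) (φ : TestSpace X) :
    seriesTerm W I₀ α φ.1 = (conjPsiBasis W I₀ hX).repr φ α * totalWeight ν I₀ α := by
  have h := seriesTerm_linearCombination W I₀ hX α ((conjPsiBasis W I₀ hX).repr φ)
  rw [← h]
  conv_lhs => rw [← (conjPsiBasis W I₀ hX).linearCombination_repr φ]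
  simp only [conjPsiBasis, Module.Basis.coe_mk]

variable {K : ∀ i, Set (X i) → ℂ} (hK : ∀ i, KernelConverges (ν i) (K i)) (m : ℕ)
  (a : (k : ℕ) → (Fin k → Fin n) → ℂ)
include hK

/-- In terms of the wavelet basis the equation `Tu = f` is diagonal. -/
lemma solvesEquation_iff (u : GenFun X) (f : LizorkinGenFun ν) :
    SolvesEquation ν K m a u f ↔ ∀ β : MWIdx X,
      eigenvalue ν K m a β.ball * u (conjPsi W I₀ β.toMIdx) = f (conjWavelet W β) := by
  have hg : ∀ i (p : WIdx (X i)), (fun x => conj ((W i).fn p.1 p.2 x)) ∈ waveletSpace (ν i) p.1.1 :=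
    fun i p => conj_mem_waveletSpace ((W i).mem p)
  constructor
  · intro h β
    obtain ⟨hmem, hu⟩ := h (conjWavelet W β)
    rw [← hu, ← smul_eq_mul, ← map_smul]
    congr 1
    refine Subtype.ext ?_
    simp only [conjWavelet_apply, Submodule.coe_smul, conjPsi_toMIdx]
    exact (pdo_prod hX hK hg m a β).symm
  · intro h φ
    obtain ⟨c, rfl⟩ := Finsupp.mem_span_range_iff_exists_finsupp.1
      (top_le_span_conjWavelet W I₀ hX (Submodule.mem_top (x := φ)))
    -- Applied to a finite combination of conjugate wavelets, `T` only rescales the coefficients;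
    -- this also shows that the result is a test function.
    have h1 : pdo ν K m a (c.sum fun β z => z • conjWavelet W β).1 =
        (∑ β ∈ c.support, (c β * eigenvalue ν K m a β.ball) • conjPsi W I₀ β.toMIdx :
          TestSpace X).1 := by
      simp only [Finsupp.sum, Submodule.coe_sum, Submodule.coe_smul, conjPsi_toMIdx,
        conjWavelet_apply]
      exact pdo_sum hX hK hg m a c.support c
    have hmem : pdo ν K m a (c.sum fun β z => z • conjWavelet W β).1 ∈ TestSpace X :=
      h1 ▸ Subtype.mem _
    refine ⟨hmem, ?_⟩
    rw [show (⟨_, hmem⟩ : TestSpace X) = _ from Subtype.ext h1]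
    simp only [map_sum, map_smul, Finsupp.sum, smul_eq_mul, ← h]
    exact Finset.sum_congr rfl fun β _ => by ring

end MultiDim

/-! ### The solution, its values on the basis and its series. -/

section Series

variable {n : ℕ} {X : Fin n → Type*} [∀ i, MetricSpace (X i)] [∀ i, IsUltrametricDist (X i)]
  [∀ i, ProperSpace (X i)] [∀ i, MeasurableSpace (X i)] [∀ i, BorelSpace (X i)]
  {ν : ∀ i, Measure (X i)} [∀ i, IsFiniteMeasureOnCompacts (ν i)]

/-- The indices of wavelets are those without the entry `none`. -/
noncomputable def wIdxEquiv (X : Fin n → Type*) [∀ i, MetricSpace (X i)] :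
    MWIdx X ≃ {α : MIdx X // ¬ ∃ i, α i = none} where
  toFun β := ⟨β.toMIdx, by rintro ⟨i, hi⟩; exact Option.some_ne_none _ hi⟩
  invFun α i := (α.1 i).get (Option.isSome_iff_ne_none.2 fun h => α.2 ⟨i, h⟩)
  left_inv β := rfl
  right_inv α := Subtype.ext <| funext fun i => Option.some_get _

/-- A finitely supported family over all indices splits into the families over initial conditions
and over two complementary sets of wavelet indices. -/
lemma hasSum_split (P : MWIdx X → Prop) (g : MIdx X → ℂ) (hg : (Function.support g).Finite) :
    ∃ s₁ s₂ s₃ : ℂ, HasSum (fun α : InitIdx X => g α.1) s₁ ∧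
      HasSum (fun β : {β : MWIdx X // ¬ P β} => g β.1.toMIdx) s₂ ∧
      HasSum (fun β : {β : MWIdx X // P β} => g β.1.toMIdx) s₃ ∧
      HasSum g (s₁ + s₂ + s₃) := by
  have hs : Summable g := summable_of_hasFiniteSupport hg
  have h1 : Summable fun α : InitIdx X => g α.1 := hs.subtype {α : MIdx X | ∃ i, α i = none}
  have h2 : Summable fun β : MWIdx X => g β.toMIdx :=
    (wIdxEquiv X).summable_iff.2 (hs.subtype {α : MIdx X | ¬ ∃ i, α i = none})
  have h3 : Summable fun β : {β : MWIdx X // ¬ P β} => g β.1.toMIdx :=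
    h2.subtype {β : MWIdx X | ¬ P β}
  have h4 : Summable fun β : {β : MWIdx X // P β} => g β.1.toMIdx := h2.subtype {β : MWIdx X | P β}
  refine ⟨_, _, _, h1.hasSum, h3.hasSum, h4.hasSum, ?_⟩
  have h5 : HasSum (fun β : MWIdx X => g β.toMIdx)
      ((∑' β : {β : MWIdx X // ¬ P β}, g β.1.toMIdx) +
        ∑' β : {β : MWIdx X // P β}, g β.1.toMIdx) := by
    rw [add_comm]
    exact HasSum.add_compl (s := {β : MWIdx X | P β}) h4.hasSum h3.hasSum
  have h6 := (wIdxEquiv X).hasSum_iff (f := fun α : {α : MIdx X // ¬ ∃ i, α i = none} => g α.1) |>.1 h5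
  rw [add_assoc]
  exact HasSum.add_compl (s := {α : MIdx X | ∃ i, α i = none}) h1.hasSum h6

variable (W : ∀ i, Wavelets (ν i)) (I₀ : ∀ i, Vertex (X i)) [∀ i, (ν i).IsOpenPosMeasure]
  (hX : ∀ i, IsRegular (X i)) {K : ∀ i, Set (X i) → ℂ} (m : ℕ) (a : (k : ℕ) → (Fin k → Fin n) → ℂ)
  (f : LizorkinGenFun ν) (u₀ : InitIdx X → ℂ)
  (c : {β : MWIdx X // IsCharacteristic ν K m a β.ball} → ℂ)

open Classical in
/-- The values on the basis `conj Ψ_{Ij}` that the solution of the Cauchy problem must take. -/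
noncomputable def solutionValue (α : MIdx X) : ℂ :=
  if h : ∃ i, α i = none then u₀ ⟨α, h⟩ * totalWeight ν I₀ α
  else
    let β : MWIdx X := (wIdxEquiv X).symm ⟨α, h⟩
    if hβ : IsCharacteristic ν K m a β.ball then c ⟨β, hβ⟩
    else 1 / eigenvalue ν K m a β.ball * f (conjWavelet W β)

lemma solutionValue_init (α : InitIdx X) :
    solutionValue W I₀ m a f u₀ c α.1 = u₀ α * totalWeight ν I₀ α.1 := by
  simp [solutionValue, α.2]

lemma solutionValue_char (β : {β : MWIdx X // IsCharacteristic ν K m a β.ball}) :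
    solutionValue W I₀ m a f u₀ c β.1.toMIdx = c β := by
  have h : ¬ ∃ i, β.1.toMIdx i = none := (wIdxEquiv X β.1).2
  rw [solutionValue, dif_neg h]
  exact dif_pos β.2

lemma solutionValue_noncharacteristic {β : MWIdx X} (hβ : ¬ IsCharacteristic ν K m a β.ball) :
    solutionValue W I₀ m a f u₀ c β.toMIdx =
      1 / eigenvalue ν K m a β.ball * f (conjWavelet W β) := by
  have h : ¬ ∃ i, β.toMIdx i = none := (wIdxEquiv X β).2
  rw [solutionValue, dif_neg h]
  exact dif_neg hβ

lemma IsSeriesSum.unique {u v : GenFun X} (hu : IsSeriesSum W I₀ K m a f u₀ c u)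
    (hv : IsSeriesSum W I₀ K m a f u₀ c v) : u = v := by
  ext φ
  obtain ⟨s₁, s₂, s₃, h1, h2, h3, h⟩ := hu φ
  obtain ⟨t₁, t₂, t₃, k1, k2, k3, k⟩ := hv φ
  rw [h, k, h1.unique k1, h2.unique k2, h3.unique k3]

include hX

/-- Each basis index carries one scalar condition. At a characteristic index the equation reads `0 =
f(conj Ψ_{Ij})`, which is `hf`, and so leaves the value free to be `c`; at a non-characteristic one
it is solved by dividing by the eigenvalue. -/
lemma isCauchySolution_iff (hK : ∀ i, KernelConverges (ν i) (K i))
    (hf : ∀ β : MWIdx X, IsCharacteristic ν K m a β.ball → f (conjWavelet W β) = 0)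
    (u : GenFun X) :
    (IsCauchySolution W I₀ K m a f u₀ u ∧ ∀ β, u (conjPsi W I₀ β.1.toMIdx) = c β) ↔
      ∀ α, u (conjPsi W I₀ α) = solutionValue W I₀ m a f u₀ c α := by
  rw [IsCauchySolution, solvesEquation_iff W I₀ hX hK]
  simp only [← totalWeight_eq]
  constructor
  · rintro ⟨⟨h1, h2⟩, h3⟩ α
    by_cases h : ∃ i, α i = none
    · exact (h2 ⟨α, h⟩).trans (solutionValue_init W I₀ m a f u₀ c ⟨α, h⟩).symm
    · obtain ⟨β, hβ⟩ := (wIdxEquiv X).surjective ⟨α, h⟩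
      obtain rfl : β.toMIdx = α := congrArg Subtype.val hβ
      by_cases hc : IsCharacteristic ν K m a β.ball
      · exact (h3 ⟨β, hc⟩).trans (solutionValue_char W I₀ m a f u₀ c ⟨β, hc⟩).symm
      · rw [solutionValue_noncharacteristic W I₀ m a f u₀ c hc, ← h1 β, ← mul_assoc,
          one_div_mul_cancel hc, one_mul]
  · intro h
    refine ⟨⟨fun β => ?_, fun α => ?_⟩, fun β => ?_⟩
    · by_cases hc : IsCharacteristic ν K m a β.ball
      · rw [hf β hc, show eigenvalue ν K m a β.ball = 0 from hc, zero_mul]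
      · rw [h, solutionValue_noncharacteristic W I₀ m a f u₀ c hc, ← mul_assoc,
          mul_one_div_cancel hc, one_mul]
    · rw [h, solutionValue_init]
    · rw [h, solutionValue_char]

/-- The functional with the prescribed values on the basis. -/
noncomputable def solution : GenFun X :=
  (conjPsiBasis W I₀ hX).constr ℂ (solutionValue W I₀ m a f u₀ c)

lemma eq_solution_iff (u : GenFun X) : u = solution W I₀ hX m a f u₀ c ↔
    ∀ α, u (conjPsi W I₀ α) = solutionValue W I₀ m a f u₀ c α := by
  constructor
  · rintro rfl α
    rw [← conjPsiBasis_apply W I₀ hX, solution, Module.Basis.constr_basis]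
  · intro h
    refine (conjPsiBasis W I₀ hX).ext fun α => ?_
    rw [solution, Module.Basis.constr_basis, conjPsiBasis_apply, h]

/-- Expand `φ` in the basis and apply the solution: a finite sum of coordinates times prescribed
values. The weight in a series term is the one contained in the initial values, and it is `1` at
wavelet indices. -/
lemma isSeriesSum_solution :
    IsSeriesSum W I₀ K m a f u₀ c (solution W I₀ hX m a f u₀ c) := by
  intro φ
  let b := conjPsiBasis W I₀ hX
  let v := solutionValue W I₀ m a f u₀ c
  have hsub : Function.support (fun α => b.repr φ α * v α) ⊆ (b.repr φ).support := fun α hα =>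
    Finsupp.mem_support_iff.2 fun h => hα (by simp [h])
  obtain ⟨s₁, s₂, s₃, h1, h2, h3, h⟩ := hasSum_split
    (fun β : MWIdx X => IsCharacteristic ν K m a β.ball) (fun α => b.repr φ α * v α)
    ((b.repr φ).support.finite_toSet.subset hsub)
  have hb := seriesTerm_eq_repr W I₀ hX
  refine ⟨s₁, s₂, s₃, h1.congr_fun fun α => ?_, h2.congr_fun fun β => ?_,
    h3.congr_fun fun β => ?_, ?_⟩
  · rw [hb]
    simp only [v, solutionValue_init]
    ring
  · rw [hb, totalWeight_toMIdx]
    simp only [v, solutionValue_noncharacteristic W I₀ m a f u₀ c β.2]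
    ring
  · rw [hb, totalWeight_toMIdx]
    simp only [v, solutionValue_char]
    ring
  · refine HasSum.unique ?_ h
    rw [solution, Module.Basis.constr_apply]
    exact hasSum_sum_of_ne_finset_zero fun α hα => by
      simp [Finsupp.notMem_support_iff.1 hα, b]

end Series

end Ultra

theorem mainTheorem1 {n : ℕ} {X : Fin n → Type*} [∀ i, MetricSpace (X i)]
    [∀ i, IsUltrametricDist (X i)] [∀ i, ProperSpace (X i)]
    (hX : ∀ i, Ultra.IsRegular (X i))
    [∀ i, MeasurableSpace (X i)] [∀ i, BorelSpace (X i)]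
    (ν : ∀ i, Measure (X i)) [∀ i, IsFiniteMeasureOnCompacts (ν i)]
    [∀ i, (ν i).IsOpenPosMeasure]
    (W : ∀ i, Ultra.Wavelets (ν i))
    (K : ∀ i, Set (X i) → ℂ) (hK : ∀ i, Ultra.KernelConverges (ν i) (K i))
    (m : ℕ) (a : (k : ℕ) → (Fin k → Fin n) → ℂ)
    (I₀ : ∀ i, Ultra.Vertex (X i)) (hI₀ : ∀ i, 0 < ν i (I₀ i).1)
    (f : Ultra.LizorkinGenFun ν) (u₀ : Ultra.InitIdx X → ℂ)
    (hf : ∀ β : Ultra.MWIdx X, Ultra.IsCharacteristic ν K m a β.ball →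
      f (Ultra.conjWavelet W β) = 0) :
    (∀ β : Ultra.MWIdx X,
      Ultra.pdo ν K m a (Ultra.wavelet W β) =
        Ultra.eigenvalue ν K m a β.ball • Ultra.wavelet W β) ∧
    (∀ c : {β : Ultra.MWIdx X // Ultra.IsCharacteristic ν K m a β.ball} → ℂ,
      ∃! u : Ultra.GenFun X, Ultra.IsCauchySolution W I₀ K m a f u₀ u ∧
        ∀ β, u (Ultra.conjPsi W I₀ β.1.toMIdx) = c β) ∧
    (∀ (c : {β : Ultra.MWIdx X // Ultra.IsCharacteristic ν K m a β.ball} → ℂ)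
      (u : Ultra.GenFun X),
      (Ultra.IsCauchySolution W I₀ K m a f u₀ u ∧
        ∀ β, u (Ultra.conjPsi W I₀ β.1.toMIdx) = c β) ↔
      Ultra.IsSeriesSum W I₀ K m a f u₀ c u) ∧
    ((∀ I : ∀ i, Ultra.BigBall (X i), ¬ Ultra.IsCharacteristic ν K m a I) →
      ∃! u : Ultra.GenFun X, Ultra.IsCauchySolution W I₀ K m a f u₀ u) := by
  have hsol := fun c u => (Ultra.isCauchySolution_iff W I₀ hX m a f u₀ c hK hf u).trans
    (Ultra.eq_solution_iff W I₀ hX m a f u₀ c u).symm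
  refine ⟨fun β => Ultra.pdo_prod hX hK (g := fun i p => (W i).fn p.1 p.2)
    (fun i p => (W i).mem p) m a β, fun c => ?_, fun c u => ?_, fun hchar => ?_⟩
  · exact ⟨Ultra.solution W I₀ hX m a f u₀ c, (hsol c _).2 rfl, fun u hu => (hsol c u).1 hu⟩
  · rw [hsol]
    have hs := Ultra.isSeriesSum_solution W I₀ hX m a f u₀ c
    exact ⟨fun h => h ▸ hs, fun h => h.unique W I₀ m a f u₀ c hs⟩
  · have : IsEmpty {β : Ultra.MWIdx X // Ultra.IsCharacteristic ν K m a β.ball} :=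
      ⟨fun β => hchar _ β.2⟩
    have hsol' := hsol isEmptyElim
    simp only [IsEmpty.forall_iff, and_true] at hsol'
    exact ⟨_, (hsol' _).2 rfl, fun u hu => (hsol' u).1 hu⟩
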